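/- Let $k$ be a positive integer. Let $\Omega_k$ be the set of $(\lambda,\mu)=(\lambda_1,\dots,\lambda_k;\mu_1,\dots,\mu_k)\in\mathbb R^{2k}$ with $\lambda_j\ge 0$, $\sum_j\lambda_j=1$ and $\mu_1<\dots<\mu_k$, and let $\mathcal S$ be the set of all probability distributions on $\mathbb R$ that are symmetric about zero. For $(\lambda,\mu)\in\Omega_k$ put $\Delta_k(\lambda,\mu)=\sum_{j}\lambda_j\delta_{\mu_j}$, write $\star$ for convolution, and write $F^-$ for the reflection of a distribution $F$ about the origin, so that $\Delta_k^-(\lambda,\mu)=\sum_j\lambda_j\delta_{-\mu_j}$. A distribution $F$ is called $k$-identifiable if there is exactly one $(\lambda,\mu,G)\in\Omega_k\times\mathcal S$ with $F=G\star\Delta_k(\lambda,\mu)$. Let $\Omega_k^*$ be the set of all $(\lambda,\mu)\in\Omega_k$ such that $G\star\Delta_k(\lambda,\mu)$ is $k$-identifiable for every $G\in\mathcal S$. For $1\le p\le\infty$ let $\mathcal D(F_1,F_2)$ be the $L_p$-distance between distribution functions, that is, $\mathcal D(F_1,F_2)=\bigl(\int_{-\infty}^{\infty}|F_1(t)-F_2(t)|^p\,dt\bigr)^{1/p}$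 if $p<\infty$ and $\mathcal D(F_1,F_2)=\sup_t|F_1(t)-F_2(t)|$ if $p=\infty$. Let $G_0\in\mathcal S$ and $(\lambda^0,\mu^0)\in\Omega_k^*$, and suppose that $G_0$ has a finite first moment (if $p=\infty$, this moment condition is not needed). Let $X_1,X_2,\dots$ be independent random variables, each with distribution $F_0=G_0\star\Delta_k(\lambda^0,\mu^0)$, let $\hat F_n$ be the empirical distribution of $X_1,\dots,X_n$, and let $$d_n(\lambda,\mu)=\mathcal D\bigl(\hat F_n\star\Delta_k^-(\lambda,\mu),\ \hat F_n^-\star\Delta_k(\lambda,\mu)\bigr).$$ Then, almost surely, $d_n$ has a minimizer over $\Omega_k$ for all sufficiently large $n$. Moreover, if $(\hat\lambda_n,\hat\mu_n)$ is an estimator that almost surely, for all sufficiently large $n$, is a minimizer of $d_n$ over $\Omega_k$ (chosen arbitrarily when there are several), then $(\hat\lambda_n,\hat\mu_n)\to(\lambda^0,\mu^0)$ almost surely as $n\to\infty$. -/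

import Mathlib

open MeasureTheory ProbabilityTheory Filter Topology
open scoped ENNReal

namespace SymMix

noncomputable section

/-- A parameter `θ = (λ, μ)` with weights `θ.1` and locations `θ.2`. -/
abbrev Param (k : ℕ) : Type := (Fin k → ℝ) × (Fin k → ℝ)

/-- The parameter space `Ω_k`: nonnegative weights with sum one, strictly increasing locations. -/
def paramSpace (k : ℕ) : Set (Param k) :=
  {θ | (∀ j, 0 ≤ θ.1 j) ∧ ∑ j, θ.1 j = 1 ∧ StrictMono θ.2}

/-- The distribution `Δ_k(λ, μ) = ∑ j, λ_j δ_{μ_j}`. -/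
def pointMix {k : ℕ} (θ : Param k) : Measure ℝ :=
  ∑ j, ENNReal.ofReal (θ.1 j) • Measure.dirac (θ.2 j)

/-- The reflection `F⁻` of a distribution about the origin. -/
def reflect (F : Measure ℝ) : Measure ℝ := F.map (fun x => -x)

/-- The set `S` of zero-symmetric probability distributions on the real line. -/
def zeroSymmetric : Set (Measure ℝ) :=
  {G | IsProbabilityMeasure G ∧ reflect G = G}

/-- The map `φ_k` that sends `(λ, μ, G)` to the mixture `G ⋆ Δ_k(λ, μ)`. -/
def mixture {k : ℕ} (x : Param k × Measure ℝ) : Measure ℝ := x.2 ∗ pointMix x.1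

/-- `F` is `k`-identifiable: it comes from exactly one element of `Ω_k × S`. -/
def IsIdentifiable (k : ℕ) (F : Measure ℝ) : Prop :=
  ∃ x : Param k × Measure ℝ, {y ∈ paramSpace k ×ˢ zeroSymmetric | mixture y = F} = {x}

/-- The set `Ω_k*` of those `(λ, μ) ∈ Ω_k` for which `G ⋆ Δ_k(λ, μ)` is `k`-identifiable for all
zero-symmetric `G`. -/
def identifiableParams (k : ℕ) : Set (Param k) :=
  {θ ∈ paramSpace k | ∀ G ∈ zeroSymmetric, IsIdentifiable k (mixture (θ, G))}

/-- The `L_p`-distance between the distribution functions of two distributions on the line;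
for `p = ∞` it is the supremum distance. -/
def lpDist (p : ℝ≥0∞) (F₁ F₂ : Measure ℝ) : ℝ≥0∞ :=
  if p = ∞ then ⨆ t : ℝ, ‖cdf F₁ t - cdf F₂ t‖ₑ
  else (∫⁻ t : ℝ, ‖cdf F₁ t - cdf F₂ t‖ₑ ^ p.toReal) ^ (1 / p.toReal)

/-- The `L_p`-distance between `F ⋆ Δ_k⁻(λ, μ)` and its reflection `F⁻ ⋆ Δ_k(λ, μ)`. -/
def asymmetry {k : ℕ} (p : ℝ≥0∞) (F : Measure ℝ) (θ : Param k) : ℝ≥0∞ :=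
  lpDist p (F ∗ reflect (pointMix θ)) (reflect F ∗ pointMix θ)

/-- The empirical distribution of the first `n` terms of a sequence. -/
def empirical (n : ℕ) (x : ℕ → ℝ) : Measure ℝ :=
  (n : ℝ≥0∞)⁻¹ • ∑ i ∈ Finset.range n, Measure.dirac (x i)

/-- The set of all minimizers over `Ω_k` of the asymmetry of the empirical distribution of the
first `n` terms of a sequence. -/
def minimizers (k : ℕ) (p : ℝ≥0∞) (n : ℕ) (x : ℕ → ℝ) : Set (Param k) :=
  {θ ∈ paramSpace k | IsMinOn (asymmetry p (empirical n x)) (paramSpace k) θ}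

end

end SymMix

/-! Write F₀ for the true mixture. Its asymmetry vanishes at θ₀, and replacing the distribution F by
another one changes the asymmetry at any θ by at most twice their L_p-distance (`asymmetry_le_add`).
Empirical distributions converge to F₀ in L_p almost surely (`ae_tendsto_lpDist_empirical`), so the
asymmetry of F₀ at a minimizer of d_n tends to zero. Consistency thus reduces to a deterministic
fact, `exists_forall_asymmetry_lt`: small asymmetry of F₀ at θ forces θ to be near θ₀. The same fact
confines minimizing sequences to a compact set, where lower semicontinuity gives existence.

If the asymmetry is exactly zero, H = F₀ ⋆ Δ(θ)⁻ is symmetric, and H ⋆ Δ(θ) = (G₀ ⋆ Δ(θ) ⋆ Δ(θ)⁻) ⋆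
Δ(θ₀) has two representations, so identifiability gives Δ(θ) = Δ(θ₀) (`pointMix_eq_of_symmetric`).
For small asymmetry a compactness argument is needed. Locations that merge in the limit are excluded
because Δ(θ₀) has k genuine atoms. The danger is weight escaping to infinity. Recentring at an
escaping location leaves the L_p norm unchanged; in the limit, the indices seen in the F₀-terms and
those seen in the reflected terms are disjoint, and F₀ ⋆ Δ(α,a)⁻ = F₀⁻ ⋆ Δ(β,b) with weights on
these disjoint index sets. Shifting the two parts oppositely and averaging then gives a k-point
distribution of zero asymmetry for every shift, although only Δ(θ₀) can have that property
(`false_of_separated_identity`). -/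

namespace SymMix

/-! ### Reflection and convolution with finite point mixtures -/

section Algebra

variable {k : ℕ} {θ : Param k}

instance (F : Measure ℝ) [IsProbabilityMeasure F] : IsProbabilityMeasure (reflect F) :=
  Measure.isProbabilityMeasure_map (by fun_prop)

instance (θ : Param k) : IsFiniteMeasure (pointMix θ) := by
  unfold pointMix
  exact ⟨by simp [ENNReal.sum_lt_top]⟩

lemma isProbabilityMeasure_pointMix (h0 : ∀ j, 0 ≤ θ.1 j) (h1 : ∑ j, θ.1 j = 1) :
    IsProbabilityMeasure (pointMix θ) := by
  refine ⟨?_⟩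
  unfold pointMix
  simp [← ENNReal.ofReal_sum_of_nonneg (fun j _ => h0 j), h1]

lemma reflect_conv (A B : Measure ℝ) [SFinite A] [SFinite B] :
    reflect (A ∗ B) = reflect A ∗ reflect B :=
  Measure.map_conv_addMonoidHom (negAddMonoidHom : ℝ →+ ℝ) measurable_neg

lemma reflect_reflect (A : Measure ℝ) : reflect (reflect A) = A := by
  unfold reflect
  rw [Measure.map_map (by fun_prop) (by fun_prop)]
  simp

lemma reflect_pointMix (θ : Param k) :
    reflect (pointMix θ) = pointMix (θ.1, fun j => -θ.2 j) := by
  unfold reflect pointMix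
  rw [Measure.map_finset_sum (by fun_prop)]
  simp [Measure.map_smul, Measure.map_dirac]

lemma conv_pointMix_apply (F : Measure ℝ) [IsProbabilityMeasure F] (θ : Param k) {s : Set ℝ}
    (hs : MeasurableSet s) :
    (F ∗ pointMix θ) s = ∑ j, ENNReal.ofReal (θ.1 j) * F ((fun x => x + θ.2 j) ⁻¹' s) := by
  rw [Measure.conv_comm, ← lintegral_indicator_one hs,
    Measure.lintegral_conv (measurable_one.indicator hs)]
  unfold pointMix
  rw [lintegral_finsetSum_measure]
  refine Finset.sum_congr rfl fun j _ => ?_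
  rw [lintegral_smul_measure, lintegral_dirac, smul_eq_mul]
  congr 1
  have : ∀ y, s.indicator (1 : ℝ → ℝ≥0∞) (θ.2 j + y)
      = ((fun x => x + θ.2 j) ⁻¹' s).indicator 1 y := by
    intro y
    rw [add_comm]
    by_cases h : y + θ.2 j ∈ s <;> simp [h]
  simp_rw [this]
  exact lintegral_indicator_one (hs.preimage (by fun_prop))

lemma cdf_conv_pointMix (F : Measure ℝ) [IsProbabilityMeasure F] (h0 : ∀ j, 0 ≤ θ.1 j)
    (h1 : ∑ j, θ.1 j = 1) (t : ℝ) :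
    cdf (F ∗ pointMix θ) t = ∑ j, θ.1 j * cdf F (t - θ.2 j) := by
  have := isProbabilityMeasure_pointMix h0 h1
  rw [cdf_eq_real, measureReal_def, conv_pointMix_apply F θ measurableSet_Iic, ENNReal.toReal_sum]
  · refine Finset.sum_congr rfl fun j _ => ?_
    rw [ENNReal.toReal_mul, ENNReal.toReal_ofReal (h0 j), cdf_eq_real, measureReal_def]
    congr 3
    ext x
    simp [le_sub_iff_add_le]
  · intro j _
    exact ENNReal.mul_ne_top (by simp) (by simp)

lemma reflect_conv_pointMix (F : Measure ℝ) [IsProbabilityMeasure F] (θ : Param k) :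
    reflect F ∗ pointMix θ = reflect (F ∗ reflect (pointMix θ)) := by
  have : IsFiniteMeasure (reflect (pointMix θ)) := by unfold reflect; infer_instance
  rw [reflect_conv, reflect_reflect]

end Algebra

/-! ### The L_p-distance between distribution functions -/

section Distance

variable {p : ℝ≥0∞}

/-- A set of full measure is dense, so it meets every interval to the right of t, and
right-continuity carries the bound to t. For p = ∞ this identifies the supremum with the essential
supremum. -/
lemma forall_le_of_ae_le {g : ℝ → ℝ≥0∞} {c : ℝ≥0∞}
    (hg : ∀ t, ContinuousWithinAt g (Set.Ioi t) t) (h : ∀ᵐ t, g t ≤ c) (t : ℝ) : g t ≤ c := by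
  refine le_of_tendsto_of_frequently (hg t) ?_
  intro hn
  obtain ⟨b, hb, hsub⟩ := (mem_nhdsGT_iff_exists_Ioo_subset).1 hn
  obtain ⟨x, hx, hx'⟩ := (Measure.dense_of_ae h).exists_between hb
  exact hsub hx' hx

lemma continuousWithinAt_cdf (F : Measure ℝ) (t : ℝ) :
    ContinuousWithinAt (cdf F) (Set.Ioi t) t :=
  ((cdf F).right_continuous t).mono Set.Ioi_subset_Ici_self

lemma measurable_cdf (F : Measure ℝ) : Measurable (cdf F) := (monotone_cdf F).measurable

lemma lpDist_eq_eLpNorm (hp : 1 ≤ p) (A B : Measure ℝ) :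
    lpDist p A B = eLpNorm (fun t => cdf A t - cdf B t) p volume := by
  unfold lpDist
  have hp0 : p ≠ 0 := (zero_lt_one.trans_le hp).ne'
  split_ifs with h
  · subst h
    rw [eLpNorm_exponent_top]
    apply le_antisymm
    · refine iSup_le fun t => ?_
      refine forall_le_of_ae_le (g := fun t => ‖cdf A t - cdf B t‖ₑ) (fun t => ?_)
        (enorm_ae_le_eLpNormEssSup (fun t => cdf A t - cdf B t) volume) t
      exact continuous_enorm.continuousAt.comp_continuousWithinAt
        ((continuousWithinAt_cdf A t).sub (continuousWithinAt_cdf B t))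
    · exact eLpNormEssSup_le_of_ae_enorm_bound (ae_of_all _ fun t =>
        le_iSup (fun t => ‖cdf A t - cdf B t‖ₑ) t)
  · rw [eLpNorm_eq_lintegral_rpow_enorm_toReal hp0 h]

lemma aestronglyMeasurable_cdf_sub (A B : Measure ℝ) :
    AEStronglyMeasurable (fun t => cdf A t - cdf B t) volume :=
  ((measurable_cdf A).sub (measurable_cdf B)).aestronglyMeasurable

lemma lpDist_triangle (hp : 1 ≤ p) (A B C : Measure ℝ) :
    lpDist p A C ≤ lpDist p A B + lpDist p B C := by
  simp_rw [lpDist_eq_eLpNorm hp]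
  refine le_trans (le_of_eq ?_) (eLpNorm_add_le (aestronglyMeasurable_cdf_sub A B)
    (aestronglyMeasurable_cdf_sub B C) hp)
  congr 1
  ext t
  simp

lemma lpDist_comm (hp : 1 ≤ p) (A B : Measure ℝ) : lpDist p A B = lpDist p B A := by
  simp_rw [lpDist_eq_eLpNorm hp]
  exact eLpNorm_sub_comm _ _ _ _

lemma lpDist_self (hp : 1 ≤ p) (A : Measure ℝ) : lpDist p A A = 0 := by
  simp [lpDist_eq_eLpNorm hp]

lemma eLpNorm_comp_sub_const {f : ℝ → ℝ} (hf : AEStronglyMeasurable f volume) (c : ℝ) :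
    eLpNorm (fun t => f (t - c)) p volume = eLpNorm f p volume :=
  eLpNorm_comp_measurePreserving hf (measurePreserving_sub_right volume c)

/-- The difference of distribution functions turns into a convex combination of its translates;
Minkowski's inequality and translation invariance do the rest. -/
lemma lpDist_conv_pointMix_le {k : ℕ} {θ : Param k} (hp : 1 ≤ p) (A B : Measure ℝ)
    [IsProbabilityMeasure A] [IsProbabilityMeasure B] (h0 : ∀ j, 0 ≤ θ.1 j)
    (h1 : ∑ j, θ.1 j = 1) :
    lpDist p (A ∗ pointMix θ) (B ∗ pointMix θ) ≤ lpDist p A B := by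
  simp_rw [lpDist_eq_eLpNorm hp, cdf_conv_pointMix _ h0 h1]
  set f : ℝ → ℝ := fun t => cdf A t - cdf B t with hf
  have hfm : Measurable f := (measurable_cdf A).sub (measurable_cdf B)
  calc eLpNorm (fun t => ∑ j, θ.1 j * cdf A (t - θ.2 j) - ∑ j, θ.1 j * cdf B (t - θ.2 j)) p volume
      = eLpNorm (∑ j, (θ.1 j) • fun t => f (t - θ.2 j)) p volume := by
        congr 1
        ext t
        simp [hf, mul_sub, Finset.sum_sub_distrib]
    _ ≤ ∑ j, eLpNorm ((θ.1 j) • fun t => f (t - θ.2 j)) p volume := by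
        refine eLpNorm_sum_le (fun j _ => ?_) hp
        exact ((hfm.comp (measurable_id.sub_const _)).const_smul _).aestronglyMeasurable
    _ = ∑ j, ENNReal.ofReal (θ.1 j) * eLpNorm f p volume := by
        refine Finset.sum_congr rfl fun j _ => ?_
        rw [eLpNorm_const_smul, eLpNorm_comp_sub_const hfm.aestronglyMeasurable,
          Real.enorm_of_nonneg (h0 j)]
    _ = eLpNorm f p volume := by
        rw [← Finset.sum_mul, ← ENNReal.ofReal_sum_of_nonneg (fun j _ => h0 j), h1]
        simp

/-- Equality can fail only where -t is an atom, which happens for countably many t. -/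
lemma cdf_reflect_ae (A : Measure ℝ) [IsProbabilityMeasure A] :
    ∀ᵐ t, cdf (reflect A) t = 1 - cdf A (-t) := by
  have h : {x : ℝ | A {x} ≠ 0}.Countable := Measure.countable_meas_pos_of_disjoint_iUnion
    (μ := A) (As := fun x : ℝ => {x}) (fun x => measurableSet_singleton x)
    (fun x y h => by simpa using h) |>.mono (fun x hx => pos_iff_ne_zero.2 hx)
  have h' : {t : ℝ | A {-t} ≠ 0}.Countable := h.preimage neg_injective
  filter_upwards [h'.ae_notMem volume] with t ht
  have ht : A {-t} = 0 := by simpa using ht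
  rw [cdf_eq_real, cdf_eq_real, ← probReal_compl_eq_one_sub measurableSet_Iic, measureReal_def,
    measureReal_def, reflect, Measure.map_apply (by fun_prop) measurableSet_Iic]
  congr 1
  have e : (fun x : ℝ => -x) ⁻¹' Set.Iic t = (Set.Iic (-t))ᶜ ∪ {-t} := by
    ext x
    simp only [Set.mem_preimage, Set.mem_Iic, Set.mem_union, Set.mem_compl_iff, not_le,
      Set.mem_singleton_iff]
    rw [neg_le, le_iff_lt_or_eq, eq_comm (a := x)]
  rw [e]
  exact measure_congr (union_ae_eq_left_of_ae_eq_empty (ae_eq_empty.2 ht))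

lemma lpDist_reflect (hp : 1 ≤ p) (A B : Measure ℝ) [IsProbabilityMeasure A]
    [IsProbabilityMeasure B] : lpDist p (reflect A) (reflect B) = lpDist p A B := by
  simp_rw [lpDist_eq_eLpNorm hp]
  rw [← eLpNorm_comp_measurePreserving (aestronglyMeasurable_cdf_sub A B)
    (Measure.measurePreserving_neg volume)]
  refine eLpNorm_congr_norm_ae ?_
  filter_upwards [cdf_reflect_ae A, cdf_reflect_ae B] with t hA hB
  simp only [Function.comp]
  rw [hA, hB, ← norm_neg]
  congr 1
  ring

lemma eq_of_cdf_ae_eq (A B : Measure ℝ) [IsProbabilityMeasure A] [IsProbabilityMeasure B]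
    (h : ∀ᵐ t, cdf A t = cdf B t) : A = B := by
  have hd : lpDist ∞ A B = 0 := by
    rw [lpDist_eq_eLpNorm (by simp), eLpNorm_eq_zero_iff (aestronglyMeasurable_cdf_sub A B)
      (by simp)]
    filter_upwards [h] with t ht
    simp [ht]
  refine Measure.eq_of_cdf A B (StieltjesFunction.ext fun t => ?_)
  simp only [lpDist, if_true, ENNReal.iSup_eq_zero, enorm_eq_zero] at hd
  exact sub_eq_zero.1 (hd t)

lemma asymmetry_le_add {k : ℕ} {θ : Param k} (hp : 1 ≤ p) (A B : Measure ℝ)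
    [IsProbabilityMeasure A] [IsProbabilityMeasure B] (h0 : ∀ j, 0 ≤ θ.1 j)
    (h1 : ∑ j, θ.1 j = 1) :
    asymmetry p A θ ≤ asymmetry p B θ + 2 * lpDist p A B := by
  unfold asymmetry
  have e1 : lpDist p (A ∗ reflect (pointMix θ)) (B ∗ reflect (pointMix θ)) ≤ lpDist p A B := by
    rw [reflect_pointMix]
    exact lpDist_conv_pointMix_le hp A B h0 h1
  have e2 : lpDist p (reflect B ∗ pointMix θ) (reflect A ∗ pointMix θ) ≤ lpDist p A B := by
    refine (lpDist_conv_pointMix_le hp _ _ h0 h1).trans ?_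
    rw [lpDist_reflect hp, lpDist_comm hp]
  calc _ ≤ lpDist p (A ∗ reflect (pointMix θ)) (B ∗ reflect (pointMix θ)) +
        (lpDist p (B ∗ reflect (pointMix θ)) (reflect B ∗ pointMix θ) +
        lpDist p (reflect B ∗ pointMix θ) (reflect A ∗ pointMix θ)) :=
        (lpDist_triangle hp _ _ _).trans (add_le_add le_rfl (lpDist_triangle hp _ _ _))
    _ ≤ lpDist p A B + (lpDist p (B ∗ reflect (pointMix θ)) (reflect B ∗ pointMix θ) +
        lpDist p A B) := by gcongr
    _ = _ := by ring

end Distance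

/-! ### Zero asymmetry determines the parameter -/

section Uniqueness

variable {k : ℕ} {θ θ₀ : Param k}

lemma pointMix_singleton (h0 : ∀ j, 0 ≤ θ.1 j) (x : ℝ) :
    pointMix θ {x} = ENNReal.ofReal (∑ j, if θ.2 j = x then θ.1 j else 0) := by
  rw [ENNReal.ofReal_sum_of_nonneg (fun j _ => by split_ifs <;> simp [h0 j])]
  simp only [pointMix, Measure.coe_finsetSum, Finset.sum_apply, Measure.smul_apply, smul_eq_mul,
    Measure.dirac_apply, Set.indicator, Set.mem_singleton_iff, Pi.one_apply]
  refine Finset.sum_congr rfl fun j _ => ?_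
  split_ifs <;> simp

lemma pointMix_singleton_ne_zero (h0 : ∀ j, 0 ≤ θ.1 j) {x : ℝ} :
    pointMix θ {x} ≠ 0 ↔ ∃ j, 0 < θ.1 j ∧ θ.2 j = x := by
  rw [pointMix_singleton h0, ← pos_iff_ne_zero, ENNReal.ofReal_pos,
    Finset.sum_pos_iff_of_nonneg (fun j _ => by split_ifs <;> simp [h0 j])]
  refine exists_congr fun j => ?_
  simp only [Finset.mem_univ, true_and]
  split_ifs with h <;> simp [h]

lemma pointMix_singleton_of_injective (h0 : ∀ j, 0 ≤ θ.1 j) (hinj : Function.Injective θ.2)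
    (j : Fin k) : pointMix θ {θ.2 j} = ENNReal.ofReal (θ.1 j) := by
  rw [pointMix_singleton h0]
  simp [hinj.eq_iff]

/-- Unordered or repeated locations give nothing new. -/
lemma exists_mem_paramSpace (h0 : ∀ j, 0 ≤ θ.1 j) (h1 : ∑ j, θ.1 j = 1) :
    ∃ θ' ∈ paramSpace k, pointMix θ' = pointMix θ := by
  classical
  have hc : (Finset.univ.image θ.2).card ≤ k := by
    simpa using Finset.card_image_le (s := Finset.univ) (f := θ.2)
  -- Padding the set of distinct locations to exactly k points; the added points receive weight
  -- zero.
  obtain ⟨T, hT, hTk⟩ := Infinite.exists_superset_card_eq _ k hc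
  set μ : Fin k ↪o ℝ := T.orderEmbOfFin hTk
  have hex : ∀ i, ∃ j, μ j = θ.2 i := fun i => by
    have : θ.2 i ∈ Set.range μ := by
      rw [Finset.range_orderEmbOfFin]
      exact hT (Finset.mem_image_of_mem _ (Finset.mem_univ i))
    exact this
  choose σ hσ using hex
  refine ⟨(fun j => ∑ i, if σ i = j then θ.1 i else 0, μ), ⟨fun j => ?_, ?_, μ.strictMono⟩, ?_⟩
  · refine Finset.sum_nonneg (s := Finset.univ) (f := fun i => if σ i = j then θ.1 i else 0) fun i _ => ?_
    split_ifs <;> simp [h0 i]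
  · simp only
    rw [Finset.sum_comm]
    simpa using h1
  · unfold pointMix
    simp only
    have : ∀ j, ENNReal.ofReal (∑ i, if σ i = j then θ.1 i else 0) • Measure.dirac (μ j)
        = ∑ i, if σ i = j then ENNReal.ofReal (θ.1 i) • Measure.dirac (μ j) else 0 := by
      intro j
      rw [ENNReal.ofReal_sum_of_nonneg (fun i _ => by split_ifs <;> simp [h0 i]),
        Finset.sum_smul]
      refine Finset.sum_congr rfl fun i _ => ?_
      split_ifs <;> simp
    simp_rw [this]
    rw [Finset.sum_comm]
    simp [hσ]

lemma eq_of_mem_identifiableParams (hθ₀ : θ₀ ∈ identifiableParams k) {G G' : Measure ℝ}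
    (hG : G ∈ zeroSymmetric) (hG' : G' ∈ zeroSymmetric) (hθ : θ ∈ paramSpace k)
    (h : G' ∗ pointMix θ = G ∗ pointMix θ₀) : θ = θ₀ := by
  obtain ⟨x, hx⟩ := hθ₀.2 G hG
  have m1 : (θ, G') ∈ ({x} : Set _) := hx ▸ ⟨⟨hθ, hG'⟩, h⟩
  have m2 : (θ₀, G) ∈ ({x} : Set _) := hx ▸ ⟨⟨hθ₀.1, hG⟩, rfl⟩
  exact congrArg Prod.fst (m1.trans m2.symm)

lemma conv_mem_zeroSymmetric {G : Measure ℝ} (hG : G ∈ zeroSymmetric) {D : Measure ℝ}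
    [IsProbabilityMeasure D] : G ∗ (D ∗ reflect D) ∈ zeroSymmetric := by
  obtain ⟨h1, h2⟩ := hG
  refine ⟨inferInstance, ?_⟩
  rw [reflect_conv, reflect_conv, reflect_reflect, h2, Measure.conv_comm (reflect D)]

/-- By commutativity, G ⋆ Δ(θ₀) ⋆ Δ(θ)⁻ ⋆ Δ(θ) is a symmetric distribution convolved with Δ(θ), and
also one convolved with Δ(θ₀). Identifiability is applied to this distribution, not to G ⋆ Δ(θ₀)
itself. -/
lemma pointMix_eq_of_symmetric (hθ₀ : θ₀ ∈ identifiableParams k) {G : Measure ℝ}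
    (hG : G ∈ zeroSymmetric) (h0 : ∀ j, 0 ≤ θ.1 j) (h1 : ∑ j, θ.1 j = 1)
    (h : mixture (θ₀, G) ∗ reflect (pointMix θ) = reflect (mixture (θ₀, G)) ∗ pointMix θ) :
    pointMix θ = pointMix θ₀ := by
  obtain ⟨θ', hθ', he⟩ := exists_mem_paramSpace h0 h1
  rw [← he] at h ⊢
  have := isProbabilityMeasure_pointMix hθ'.1 hθ'.2.1
  have := isProbabilityMeasure_pointMix hθ₀.1.1 hθ₀.1.2.1
  have := hG.1
  unfold mixture at h
  simp only at h
  have hH : (G ∗ pointMix θ₀) ∗ reflect (pointMix θ') ∈ zeroSymmetric := by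
    refine ⟨inferInstance, ?_⟩
    rw [← reflect_conv_pointMix, h]
  rw [eq_of_mem_identifiableParams hθ₀ (conv_mem_zeroSymmetric hG (D := pointMix θ')) hH hθ']
  simp_rw [Measure.conv_assoc]
  congr 1
  rw [Measure.conv_comm (reflect _), ← Measure.conv_assoc, Measure.conv_comm (pointMix θ₀),
    Measure.conv_assoc, Measure.conv_comm (pointMix θ₀)]

lemma isOpen_strictMono : IsOpen {μ : Fin k → ℝ | StrictMono μ} := by
  have : {μ : Fin k → ℝ | StrictMono μ} = ⋂ i, ⋂ j, {μ | i < j → μ i < μ j} := by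
    ext μ
    simp [StrictMono]
  rw [this]
  refine isOpen_iInter_of_finite fun i => isOpen_iInter_of_finite fun j => ?_
  by_cases h : i < j
  · simpa [h] using isOpen_lt (continuous_apply i) (continuous_apply j)
  · simp [h]

/-- A location of weight zero could be moved slightly without changing the mixture, contradicting
identifiability. -/
lemma weight_pos_of_mem_identifiableParams (hθ₀ : θ₀ ∈ identifiableParams k) {G : Measure ℝ}
    (hG : G ∈ zeroSymmetric) (j : Fin k) : 0 < θ₀.1 j := by
  refine (hθ₀.1.1 j).lt_of_ne' fun hj => ?_
  have hc : Continuous fun ε : ℝ => Function.update θ₀.2 j (θ₀.2 j + ε) := by fun_prop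
  have hn : ∀ᶠ ε in 𝓝 (0 : ℝ), StrictMono (Function.update θ₀.2 j (θ₀.2 j + ε)) :=
    hc.continuousAt.eventually (isOpen_strictMono.mem_nhds (by simpa using hθ₀.1.2.2))
  obtain ⟨ε, hε, hε0⟩ := ((hn.filter_mono nhdsWithin_le_nhds).and
    (self_mem_nhdsWithin (s := Set.Ioi (0 : ℝ)))).exists
  have he : pointMix (θ₀.1, Function.update θ₀.2 j (θ₀.2 j + ε)) = pointMix θ₀ := by
    unfold pointMix
    refine Finset.sum_congr rfl fun i _ => ?_
    by_cases hi : i = j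
    · subst hi
      simp [hj]
    · simp [hi]
  have := eq_of_mem_identifiableParams (θ := (θ₀.1, Function.update θ₀.2 j (θ₀.2 j + ε)))
    hθ₀ hG hG ⟨hθ₀.1.1, hθ₀.1.2.1, hε⟩ (by rw [he])
  have h2 := congrFun (congrArg Prod.snd this) j
  simp only [Function.update_self, add_eq_left] at h2
  exact hε0.ne' h2

/-- Pigeonhole: the k atoms of Δ(θ₀) use k different indices of θ, so no index is left over for zero
weight or another location. -/
lemma weight_pos_of_pointMix_eq (hθ₀ : θ₀ ∈ paramSpace k) (hpos : ∀ j, 0 < θ₀.1 j)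
    (h0 : ∀ j, 0 ≤ θ.1 j) (h : pointMix θ = pointMix θ₀) (j : Fin k) :
    0 < θ.1 j ∧ θ.2 j ∈ Set.range θ₀.2 := by
  have hex : ∀ j, ∃ i, 0 < θ.1 i ∧ θ.2 i = θ₀.2 j := fun j => by
    rw [← pointMix_singleton_ne_zero h0, h, pointMix_singleton_ne_zero hθ₀.1]
    exact ⟨j, hpos j, rfl⟩
  choose σ h1 h2 using hex
  have hinj : Function.Injective σ := fun a b hab =>
    hθ₀.2.2.injective (by rw [← h2, ← h2, hab])
  obtain ⟨i, rfl⟩ := (Finite.injective_iff_surjective.1 hinj) j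
  exact ⟨h1 i, i, (h2 i).symm⟩

lemma eq_of_pointMix_eq (hθ₀ : θ₀ ∈ paramSpace k) (hpos : ∀ j, 0 < θ₀.1 j)
    (h0 : ∀ j, 0 ≤ θ.1 j) (hmono : Monotone θ.2) (h : pointMix θ = pointMix θ₀) : θ = θ₀ := by
  have hex : ∀ j, ∃ i, 0 < θ.1 i ∧ θ.2 i = θ₀.2 j := fun j => by
    rw [← pointMix_singleton_ne_zero h0, h, pointMix_singleton_ne_zero hθ₀.1]
    exact ⟨j, hpos j, rfl⟩
  choose σ h1 h2 using hex
  have hinj : Function.Injective σ := fun a b hab =>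
    hθ₀.2.2.injective (by rw [← h2, ← h2, hab])
  have hsurj := Finite.injective_iff_surjective.1 hinj
  have hs : Function.Injective θ.2 := by
    intro a b hab
    obtain ⟨a, rfl⟩ := hsurj a
    obtain ⟨b, rfl⟩ := hsurj b
    rw [h2, h2] at hab
    rw [hθ₀.2.2.injective hab]
  have hloc : θ.2 = θ₀.2 := by
    refine ((hmono.strictMono_of_injective hs).range_inj hθ₀.2.2).1 ?_
    apply Set.Subset.antisymm
    · rintro _ ⟨j, rfl⟩
      exact (weight_pos_of_pointMix_eq hθ₀ hpos h0 h j).2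
    · rintro _ ⟨j, rfl⟩
      exact ⟨σ j, h2 j⟩
  refine Prod.ext (funext fun j => ?_) hloc
  have := pointMix_singleton_of_injective h0 hs j
  rw [hloc, h, pointMix_singleton_of_injective hθ₀.1 hθ₀.2.2.injective j] at this
  exact ((ENNReal.ofReal_eq_ofReal_iff (hθ₀.1 j) (h0 j)).1 this).symm

end Uniqueness

/-! ### Fatou's lemma along locations that may diverge -/

section LowerSemicontinuity

/-- The distribution function, extended to the two-point compactification of the line. -/
noncomputable def extCdf (F : Measure ℝ) (y : EReal) : ℝ :=
  if y = ⊤ then 1 else if y = ⊥ then 0 else cdf F y.toReal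

lemma extCdf_add_coe (F : Measure ℝ) (t c : ℝ) : extCdf F ((t : EReal) + (c : EReal)) =
    cdf F (t + c) := by
  rw [← EReal.coe_add, extCdf, if_neg (EReal.coe_ne_top _), if_neg (EReal.coe_ne_bot _),
    EReal.toReal_coe]

lemma extCdf_add_of_eq_top_or_bot (F : Measure ℝ) {y : EReal} (hy : y = ⊤ ∨ y = ⊥) :
    ∃ c, ∀ t : ℝ, extCdf F ((t : EReal) + y) = c := by
  rcases hy with rfl | rfl
  · exact ⟨1, fun t => by simp [extCdf]⟩
  · exact ⟨0, fun t => by simp [extCdf]⟩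

/-- For a finite limit c, convergence can fail only when t + c is one of the countably many
discontinuities; for an infinite limit it holds everywhere. -/
lemma tendsto_cdf_extCdf (F : Measure ℝ) {u : ℕ → ℝ} {y : EReal}
    (hu : Tendsto (fun m => (u m : EReal)) atTop (𝓝 y)) :
    ∀ᵐ t : ℝ, Tendsto (fun m => cdf F (t + u m)) atTop (𝓝 (extCdf F ((t : EReal) + y))) := by
  induction y with
  | bot =>
    refine ae_of_all _ fun t => ?_
    simpa [extCdf, Function.comp_def] using (tendsto_cdf_atBot F).comp
      (tendsto_atBot_add_const_left _ t (EReal.tendsto_coe_nhds_bot_iff.1 hu))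
  | top =>
    refine ae_of_all _ fun t => ?_
    simpa [extCdf, Function.comp_def] using (tendsto_cdf_atTop F).comp
      (tendsto_atTop_add_const_left _ t (EReal.tendsto_coe_nhds_top_iff.1 hu))
  | coe c =>
    have hc := ((monotone_cdf F).countable_not_continuousAt.preimage (add_left_injective c))
    filter_upwards [hc.ae_notMem volume] with t ht
    simp only [Set.preimage_ofPred_eq, Set.mem_ofPred_eq, not_not] at ht
    rw [extCdf_add_coe]
    exact ht.tendsto.comp ((EReal.tendsto_coe.1 hu).const_add t)

variable {k : ℕ} {p : ℝ≥0∞}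

lemma asymmetry_eq_eLpNorm {θ : Param k} (hp : 1 ≤ p) (F : Measure ℝ) [IsProbabilityMeasure F]
    (h0 : ∀ j, 0 ≤ θ.1 j) (h1 : ∑ j, θ.1 j = 1) :
    asymmetry p F θ = eLpNorm (fun t => ∑ j, θ.1 j * (cdf F (t + θ.2 j) -
      cdf (reflect F) (t + -θ.2 j))) p volume := by
  unfold asymmetry
  rw [lpDist_eq_eLpNorm hp, reflect_pointMix]
  simp_rw [cdf_conv_pointMix (reflect F) h0 h1,
    cdf_conv_pointMix F (θ := (θ.1, fun j => -θ.2 j)) h0 h1]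
  simp only [mul_sub, Finset.sum_sub_distrib]
  simp only [sub_eq_add_neg, neg_neg]

lemma eLpNorm_extCdf_le_liminf (F F' : Measure ℝ) {w : ℕ → Fin k → ℝ} {w' : Fin k → ℝ}
    (hw : ∀ j, Tendsto (fun m => w m j) atTop (𝓝 (w' j))) {u v : ℕ → Fin k → ℝ}
    {y z : Fin k → EReal}
    (hu : ∀ j, Tendsto (fun m => (u m j : EReal)) atTop (𝓝 (y j)))
    (hv : ∀ j, Tendsto (fun m => (v m j : EReal)) atTop (𝓝 (z j))) :
    eLpNorm (fun t : ℝ => ∑ j, w' j * (extCdf F ((t : EReal) + y j) -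
      extCdf F' ((t : EReal) + z j))) p volume ≤
    liminf (fun m => eLpNorm (fun t => ∑ j, w m j * (cdf F (t + u m j) -
      cdf F' (t + v m j))) p volume) atTop := by
  refine Lp.eLpNorm_lim_le_liminf_eLpNorm (fun m => ?_) _ ?_
  · refine Measurable.aestronglyMeasurable ?_
    have := measurable_cdf F
    have := measurable_cdf F'
    fun_prop
  · have h1 := ae_all_iff.2 fun j => tendsto_cdf_extCdf F (hu j)
    have h2 := ae_all_iff.2 fun j => tendsto_cdf_extCdf F' (hv j)
    filter_upwards [h1, h2] with t ht1 ht2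
    exact tendsto_finsetSum _ fun j _ => (hw j).mul ((ht1 j).sub (ht2 j))

lemma ae_sum_extCdf_eq_zero (hp : 1 ≤ p) (F F' : Measure ℝ) {w : ℕ → Fin k → ℝ} {w' : Fin k → ℝ}
    (hw : ∀ j, Tendsto (fun m => w m j) atTop (𝓝 (w' j))) {u v : ℕ → Fin k → ℝ}
    {y z : Fin k → EReal}
    (hu : ∀ j, Tendsto (fun m => (u m j : EReal)) atTop (𝓝 (y j)))
    (hv : ∀ j, Tendsto (fun m => (v m j : EReal)) atTop (𝓝 (z j)))
    (h : Tendsto (fun m => eLpNorm (fun t => ∑ j, w m j * (cdf F (t + u m j) -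
      cdf F' (t + v m j))) p volume) atTop (𝓝 0)) :
    ∀ᵐ t : ℝ, ∑ j, w' j * (extCdf F ((t : EReal) + y j) - extCdf F' ((t : EReal) + z j)) = 0 := by
  have hle := eLpNorm_extCdf_le_liminf (p := p) F F' hw hu hv
  rw [h.liminf_eq, nonpos_iff_eq_zero, eLpNorm_eq_zero_iff ?_
    (zero_lt_one.trans_le hp).ne'] at hle
  · exact hle
  · refine aestronglyMeasurable_of_tendsto_ae atTop (f := fun m t => ∑ j, w m j *
      (cdf F (t + u m j) - cdf F' (t + v m j))) (fun m => ?_) ?_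
    · refine Measurable.aestronglyMeasurable ?_
      have := measurable_cdf F
      have := measurable_cdf F'
      fun_prop
    · have h1 := ae_all_iff.2 fun j => tendsto_cdf_extCdf F (hu j)
      have h2 := ae_all_iff.2 fun j => tendsto_cdf_extCdf F' (hv j)
      filter_upwards [h1, h2] with t ht1 ht2
      exact tendsto_finsetSum _ fun j _ => (hw j).mul ((ht1 j).sub (ht2 j))

end LowerSemicontinuity

/-! ### Small asymmetry forces closeness to the true parameter -/

section Identification

variable {k : ℕ} {θ₀ : Param k} {G : Measure ℝ}

/-- Lets an almost everywhere identity be evaluated at ±∞. -/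
lemma eq_const_of_tendsto_of_ae_eq {g : ℝ → ℝ} {C L : ℝ} {l : Filter ℝ}
    (hl : ∀ s ∈ l, volume s ≠ 0) (hg : Tendsto g l (𝓝 L)) (h : ∀ᵐ t, g t = C) : C = L := by
  have hfr : ∃ᶠ t in l, g t ∈ ({C} : Set ℝ) := fun hn =>
    hl _ hn (measure_mono_null (fun t ht => ht) h)
  exact (isClosed_singleton.mem_of_frequently_of_tendsto hfr hg).symm

lemma volume_ne_zero_of_mem_atBot {s : Set ℝ} (hs : s ∈ (atBot : Filter ℝ)) : volume s ≠ 0 := by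
  obtain ⟨a, ha⟩ := mem_atBot_sets.1 hs
  have : volume (Set.Iic a) ≤ volume s := measure_mono ha
  simp only [Real.volume_Iic, top_le_iff] at this
  simp [this]

lemma volume_ne_zero_of_mem_atTop {s : Set ℝ} (hs : s ∈ (atTop : Filter ℝ)) : volume s ≠ 0 := by
  obtain ⟨a, ha⟩ := mem_atTop_sets.1 hs
  have : volume (Set.Ici a) ≤ volume s := measure_mono ha
  simp only [Real.volume_Ici, top_le_iff] at this
  simp [this]

/-- Disjointness of A and B allows one k-point parameter to carry both families of locations.
Opposite shifts preserve its symmetry, so the location of index i can be any real s, whereas it must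
lie in the finite range of `θ₀.2`. -/
lemma false_of_separated_identity (hθ₀ : θ₀ ∈ identifiableParams k) (hG : G ∈ zeroSymmetric)
    {w : Fin k → ℝ} (hw : ∀ j, 0 ≤ w j) {A B : Finset (Fin k)} (hAB : Disjoint A B) {i : Fin k}
    (hi : i ∈ A) (hwi : 0 < w i) (a b : Fin k → ℝ) (C : ℝ)
    (h : ∀ᵐ t, ∑ j ∈ A, w j * cdf (mixture (θ₀, G)) (t + a j) -
      ∑ j ∈ B, w j * cdf (reflect (mixture (θ₀, G))) (t - b j) = C) : False := by
  classical
  have := isProbabilityMeasure_pointMix hθ₀.1.1 hθ₀.1.2.1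
  have := hG.1
  have hF : IsProbabilityMeasure (mixture (θ₀, G)) := by unfold mixture; infer_instance
  have hpos := weight_pos_of_mem_identifiableParams hθ₀ hG
  set F := mixture (θ₀, G) with hFdef
  -- The limit at -∞ gives C = 0, and the limit at +∞ then shows that A and B carry the same total
  -- weight e.
  have hC : C = 0 := by
    refine eq_const_of_tendsto_of_ae_eq (fun s => volume_ne_zero_of_mem_atBot) ?_ h
    have h1 : Tendsto (fun t => ∑ j ∈ A, w j * cdf F (t + a j)) atBot (𝓝 (∑ j ∈ A, w j * 0)) :=
      tendsto_finsetSum _ fun j _ => ((tendsto_cdf_atBot F).comp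
        (tendsto_atBot_add_const_right _ (a j) tendsto_id)).const_mul _
    have h2 : Tendsto (fun t => ∑ j ∈ B, w j * cdf (reflect F) (t - b j)) atBot
        (𝓝 (∑ j ∈ B, w j * 0)) :=
      tendsto_finsetSum _ fun j _ => ((tendsto_cdf_atBot (reflect F)).comp
        (tendsto_atBot_add_const_right _ (-b j) tendsto_id)).const_mul _
    simpa using h1.sub h2
  have hsum : C = ∑ j ∈ A, w j - ∑ j ∈ B, w j := by
    refine eq_const_of_tendsto_of_ae_eq (fun s => volume_ne_zero_of_mem_atTop) ?_ h
    have h1 : Tendsto (fun t => ∑ j ∈ A, w j * cdf F (t + a j)) atTop (𝓝 (∑ j ∈ A, w j * 1)) :=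
      tendsto_finsetSum _ fun j _ => ((tendsto_cdf_atTop F).comp
        (tendsto_atTop_add_const_right _ (a j) tendsto_id)).const_mul _
    have h2 : Tendsto (fun t => ∑ j ∈ B, w j * cdf (reflect F) (t - b j)) atTop
        (𝓝 (∑ j ∈ B, w j * 1)) :=
      tendsto_finsetSum _ fun j _ => ((tendsto_cdf_atTop (reflect F)).comp
        (tendsto_atTop_add_const_right _ (-b j) tendsto_id)).const_mul _
    simpa using h1.sub h2
  set e := ∑ j ∈ A, w j with he
  have heB : ∑ j ∈ B, w j = e := by linarith
  have hepos : 0 < e := Finset.sum_pos' (fun j _ => hw j) ⟨i, hi, hwi⟩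
  set α : Fin k → ℝ := fun j => if j ∈ A then w j / e else 0 with hα
  set β : Fin k → ℝ := fun j => if j ∈ B then w j / e else 0 with hβ
  have hα0 : ∀ j, 0 ≤ α j := fun j => by
    simp only [hα]; split_ifs <;> simp [div_nonneg, hw j, hepos.le]
  have hβ0 : ∀ j, 0 ≤ β j := fun j => by
    simp only [hβ]; split_ifs <;> simp [div_nonneg, hw j, hepos.le]
  have hα1 : ∑ j, α j = 1 := by
    simp only [hα, Finset.sum_ite_mem, Finset.univ_inter]
    rw [← Finset.sum_div, ← he, div_self hepos.ne']
  have hβ1 : ∑ j, β j = 1 := by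
    simp only [hβ, Finset.sum_ite_mem, Finset.univ_inter]
    rw [← Finset.sum_div, heB, div_self hepos.ne']
  have := isProbabilityMeasure_pointMix (θ := (α, a)) hα0 hα1
  have := isProbabilityMeasure_pointMix (θ := (β, b)) hβ0 hβ1
  have hrA : ∀ t, cdf (F ∗ reflect (pointMix (α, a))) t = ∑ j, α j * cdf F (t + a j) := fun t => by
    rw [reflect_pointMix, cdf_conv_pointMix F hα0 hα1]
    simp only [sub_neg_eq_add]
  have hrB : ∀ t, cdf (F ∗ reflect (pointMix (β, b))) t = ∑ j, β j * cdf F (t + b j) := fun t => by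
    rw [reflect_pointMix, cdf_conv_pointMix F hβ0 hβ1]
    simp only [sub_neg_eq_add]
  have hE1 : F ∗ reflect (pointMix (α, a)) = reflect F ∗ pointMix (β, b) := by
    refine eq_of_cdf_ae_eq _ _ ?_
    filter_upwards [h] with t ht
    rw [hrA, cdf_conv_pointMix _ hβ0 hβ1]
    simp only [hα, hβ, ite_mul, zero_mul, Finset.sum_ite_mem, Finset.univ_inter, div_mul_eq_mul_div]
    rw [← Finset.sum_div, ← Finset.sum_div]
    congr 1
    linarith
  have hE2 : reflect F ∗ pointMix (α, a) = F ∗ reflect (pointMix (β, b)) := by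
    have := congrArg reflect hE1
    rwa [reflect_conv, reflect_conv, reflect_reflect, reflect_reflect] at this
  have key : ∀ s, s ∈ Set.range θ₀.2 := by
    intro s
    -- The shift s - a i puts index i at s; the opposite shift on B exchanges the two sides of `hE1`
    -- and `hE2`.
    set γ : Param k := (fun j => (α j + β j) / 2,
      fun j => if j ∈ A then a j - a i + s else b j + a i - s) with hγ
    have hγ0 : ∀ j, 0 ≤ γ.1 j := fun j => by
      have := hα0 j
      have := hβ0 j
      simp only [hγ]
      positivity
    have hγ1 : ∑ j, γ.1 j = 1 := by
      simp only [hγ]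
      rw [← Finset.sum_div, Finset.sum_add_distrib, hα1, hβ1]
      norm_num
    have hsplit : ∀ (f : ℝ → ℝ), ∑ j, γ.1 j * f (γ.2 j) =
        ((∑ j, α j * f (a j - a i + s)) + ∑ j, β j * f (b j + a i - s)) / 2 := by
      intro f
      rw [← Finset.sum_add_distrib, Finset.sum_div]
      refine Finset.sum_congr rfl fun j _ => ?_
      by_cases hj : j ∈ A
      · have hjB : j ∉ B := Finset.disjoint_left.1 hAB hj
        simp only [hγ, hα, hβ, hj, hjB, if_true, if_false]
        ring
      · simp only [hγ, hα, hj, if_false]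
        ring
    have heq : pointMix γ = pointMix θ₀ := by
      refine pointMix_eq_of_symmetric hθ₀ hG hγ0 hγ1 ?_
      rw [← hFdef]
      have := isProbabilityMeasure_pointMix hγ0 hγ1
      refine eq_of_cdf_ae_eq _ _ (ae_of_all _ fun t => ?_)
      rw [reflect_pointMix, cdf_conv_pointMix F (θ := (γ.1, fun j => -γ.2 j)) hγ0 hγ1, cdf_conv_pointMix _ hγ0 hγ1]
      simp only [sub_neg_eq_add]
      rw [hsplit (fun x => cdf F (t + x)), hsplit (fun x => cdf (reflect F) (t - x))]
      have e1 : ∀ u, ∑ j, α j * cdf F (u + a j) = ∑ j, β j * cdf (reflect F) (u - b j) :=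
        fun u => by rw [← hrA, hE1, cdf_conv_pointMix _ hβ0 hβ1]
      have e2 : ∀ u, ∑ j, α j * cdf (reflect F) (u - a j) = ∑ j, β j * cdf F (u + b j) :=
        fun u => by rw [← hrB, ← hE2, cdf_conv_pointMix _ hα0 hα1]
      have f1 := e1 (t - a i + s)
      have f2 := e2 (t + a i - s)
      congr 1
      calc _ = ∑ j, α j * cdf F (t - a i + s + a j) + ∑ j, β j * cdf F (t + a i - s + b j) := by
            congr 1 <;> refine Finset.sum_congr rfl fun j _ => ?_ <;> congr 2 <;> ring
        _ = ∑ j, α j * cdf (reflect F) (t + a i - s - a j) +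
            ∑ j, β j * cdf (reflect F) (t - a i + s - b j) := by rw [f1, f2, add_comm]
        _ = _ := by
            congr 1 <;> refine Finset.sum_congr rfl fun j _ => ?_ <;> congr 2 <;> ring
    have := (weight_pos_of_pointMix_eq hθ₀.1 hpos hγ0 heq i).2
    simpa [hγ, hi] using this
  obtain ⟨s, hs⟩ := (Set.finite_range θ₀.2).exists_notMem
  exact hs (key s)

/-- An index with an infinite limit contributes a constant in t, absorbed into C. -/
lemma ae_split_of_sum_extCdf {F F' : Measure ℝ} {w : Fin k → ℝ} {y z : Fin k → EReal}
    {A B : Finset (Fin k)} (hA : ∀ j, j ∈ A ↔ y j ≠ ⊤ ∧ y j ≠ ⊥)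
    (hB : ∀ j, j ∈ B ↔ z j ≠ ⊤ ∧ z j ≠ ⊥)
    (h : ∀ᵐ t : ℝ, ∑ j, w j * (extCdf F ((t : EReal) + y j) - extCdf F' ((t : EReal) + z j)) = 0) :
    ∃ C, ∀ᵐ t : ℝ, ∑ j ∈ A, w j * cdf F (t + (y j).toReal) -
      ∑ j ∈ B, w j * cdf F' (t + (z j).toReal) = C := by
  classical
  have gen : ∀ (F : Measure ℝ) (y : Fin k → EReal) (A : Finset (Fin k)),
      (∀ j, j ∈ A ↔ y j ≠ ⊤ ∧ y j ≠ ⊥) → ∃ c, ∀ t : ℝ, ∑ j, w j * extCdf F ((t : EReal) + y j) =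
      ∑ j ∈ A, w j * cdf F (t + (y j).toReal) + c := by
    intro F y A hA
    have : ∀ j, ∃ c, j ∉ A → ∀ t : ℝ, extCdf F ((t : EReal) + y j) = c := fun j => by
      by_cases hj : j ∈ A
      · exact ⟨0, fun h => absurd hj h⟩
      · rw [hA] at hj
        obtain ⟨c, hc⟩ := extCdf_add_of_eq_top_or_bot F (y := y j) (by tauto)
        exact ⟨c, fun _ => hc⟩
    choose c hc using this
    refine ⟨∑ j ∈ Aᶜ, w j * c j, fun t => ?_⟩
    rw [← Finset.sum_add_sum_compl A]
    congr 1
    · refine Finset.sum_congr rfl fun j hj => ?_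
      rw [← extCdf_add_coe, EReal.coe_toReal ((hA j).1 hj).1 ((hA j).1 hj).2]
    · refine Finset.sum_congr rfl fun j hj => ?_
      rw [hc j (Finset.mem_compl.1 hj)]
  obtain ⟨c, hc⟩ := gen F y A hA
  obtain ⟨c', hc'⟩ := gen F' z B hB
  refine ⟨c' - c, ?_⟩
  filter_upwards [h] with t ht
  simp only [mul_sub, Finset.sum_sub_distrib] at ht
  rw [hc, hc'] at ht
  linarith

lemma tendsto_of_asymmetry_tendsto_of_extended_limits {p : ℝ≥0∞} (hp : 1 ≤ p)
    (hθ₀ : θ₀ ∈ identifiableParams k) (hG : G ∈ zeroSymmetric) {θ : ℕ → Param k}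
    (hθ : ∀ m, θ m ∈ paramSpace k)
    (h : Tendsto (fun m => asymmetry p (mixture (θ₀, G)) (θ m)) atTop (𝓝 0))
    {w : Fin k → ℝ} {y : Fin k → EReal} {d s : Fin k × Fin k → EReal}
    (hw : ∀ j, Tendsto (fun m => (θ m).1 j) atTop (𝓝 (w j)))
    (hy : ∀ j, Tendsto (fun m => (((θ m).2 j : ℝ) : EReal)) atTop (𝓝 (y j)))
    (hd : ∀ j, Tendsto (fun m => (((θ m).2 j.1 - (θ m).2 j.2 : ℝ) : EReal)) atTop (𝓝 (d j)))
    (hs : ∀ j, Tendsto (fun m => ((-(θ m).2 j.1 - (θ m).2 j.2 : ℝ) : EReal)) atTop (𝓝 (s j))) :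
    Tendsto θ atTop (𝓝 θ₀) := by
  classical
  have := isProbabilityMeasure_pointMix hθ₀.1.1 hθ₀.1.2.1
  have := hG.1
  have hF : IsProbabilityMeasure (mixture (θ₀, G)) := by unfold mixture; infer_instance
  have hpos := weight_pos_of_mem_identifiableParams hθ₀ hG
  set F := mixture (θ₀, G) with hFdef
  have hw0 : ∀ j, 0 ≤ w j := fun j => ge_of_tendsto' (hw j) fun m => (hθ m).1 j
  have hw1 : ∑ j, w j = 1 := by
    refine tendsto_nhds_unique (tendsto_finsetSum _ fun j _ => hw j) ?_
    simp [(hθ _).2.1]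
  -- Used with x = μ_i to recentre at an escaping location, and with x = 0 for the final limit.
  have has : ∀ m (x : ℝ), eLpNorm (fun t => ∑ j, (θ m).1 j * (cdf F (t + ((θ m).2 j - x)) -
      cdf (reflect F) (t + (-(θ m).2 j - x)))) p volume = asymmetry p F (θ m) := by
    intro m x
    rw [asymmetry_eq_eLpNorm hp F (hθ m).1 (hθ m).2.1]
    symm
    rw [← eLpNorm_comp_sub_const _ x]
    · congr 1
      ext t
      refine Finset.sum_congr rfl fun j _ => ?_
      congr 3 <;> ring
    · refine Measurable.aestronglyMeasurable ?_
      have := measurable_cdf F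
      have := measurable_cdf (reflect F)
      fun_prop
  have hfin : ∀ i, 0 < w i → y i ≠ ⊤ ∧ y i ≠ ⊥ := by
    intro i hwi
    by_contra hyi
    have h0 := ae_sum_extCdf_eq_zero hp F (reflect F) hw (fun j => hd (j, i)) (fun j => hs (j, i))
      (by simpa only [has] using h)
    obtain ⟨C, hC⟩ := ae_split_of_sum_extCdf
      (A := Finset.univ.filter fun j => d (j, i) ≠ ⊤ ∧ d (j, i) ≠ ⊥)
      (B := Finset.univ.filter fun j => s (j, i) ≠ ⊤ ∧ s (j, i) ≠ ⊥) (by simp) (by simp) h0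
    refine false_of_separated_identity hθ₀ hG hw0 ?_ (i := i) ?_ hwi (fun j => (d (j, i)).toReal)
      (fun j => -(s (j, i)).toReal) C (by simpa only [sub_neg_eq_add] using hC)
    -- If μ_j - μ_i and -μ_j - μ_i both had finite limits, so would μ_i, which is -1/2 times their
    -- sum.
    · rw [Finset.disjoint_left]
      intro j hj hj'
      simp only [Finset.mem_filter, Finset.mem_univ, true_and] at hj hj'
      have h1 := hd (j, i)
      have h2 := hs (j, i)
      rw [← EReal.coe_toReal hj.1 hj.2, EReal.tendsto_coe] at h1
      rw [← EReal.coe_toReal hj'.1 hj'.2, EReal.tendsto_coe] at h2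
      have h3 := EReal.tendsto_coe.2 ((h1.add h2).const_mul (-1 / 2))
      have h4 := tendsto_nhds_unique (hy i) (h3.congr fun m => by congr 1; ring)
      exact hyi (h4 ▸ ⟨EReal.coe_ne_top _, EReal.coe_ne_bot _⟩)
    · have : d (i, i) = ((0 : ℝ) : EReal) := by
        refine tendsto_nhds_unique (hd (i, i)) ?_
        simp
      simp [this]
  have hny : ∀ j, Tendsto (fun m => ((-(θ m).2 j - 0 : ℝ) : EReal)) atTop (𝓝 (-y j)) := by
    intro j
    simp only [sub_zero, EReal.coe_neg]
    exact (continuous_neg.tendsto (y j)).comp (hy j)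
  have h0 := ae_sum_extCdf_eq_zero hp F (reflect F) hw (u := fun m j => (θ m).2 j - 0)
    (by simpa using hy) hny (by simpa only [has] using h)
  -- An infinite `y j` has weight zero, so its default value under `toReal` is harmless here; `heq`
  -- afterwards makes all weights positive and hence all limits finite.
  have heq : pointMix (w, fun j => (y j).toReal) = pointMix θ₀ := by
    refine pointMix_eq_of_symmetric hθ₀ hG hw0 hw1 ?_
    rw [← hFdef]
    have := isProbabilityMeasure_pointMix (θ := (w, fun j => (y j).toReal)) hw0 hw1
    refine eq_of_cdf_ae_eq _ _ ?_
    filter_upwards [h0] with t ht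
    rw [reflect_pointMix, cdf_conv_pointMix F hw0 hw1, cdf_conv_pointMix _ hw0 hw1,
      ← sub_eq_zero, ← Finset.sum_sub_distrib, ← ht]
    refine Finset.sum_congr rfl fun j _ => ?_
    rcases (hw0 j).eq_or_lt with hj | hj
    · simp [← hj]
    · obtain ⟨r, hr⟩ : ∃ r : ℝ, y j = r := ⟨_, (EReal.coe_toReal (hfin j hj).1 (hfin j hj).2).symm⟩
      rw [hr, ← EReal.coe_neg, extCdf_add_coe, extCdf_add_coe]
      simp only [hr, EReal.toReal_coe, sub_neg_eq_add, mul_sub]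
      simp only [sub_eq_add_neg]
  have hy' : ∀ j, Tendsto (fun m => (θ m).2 j) atTop (𝓝 (y j).toReal) := fun j => by
    have hj := hfin j (weight_pos_of_pointMix_eq hθ₀.1 hpos hw0 heq j).1
    rw [← EReal.tendsto_coe, EReal.coe_toReal hj.1 hj.2]
    exact hy j
  have hmono : Monotone fun j => (y j).toReal := fun i j hij =>
    le_of_tendsto_of_tendsto' (hy' i) (hy' j) fun m => (hθ m).2.2.monotone hij
  rw [← eq_of_pointMix_eq hθ₀.1 hpos hw0 hmono heq]
  exact (tendsto_pi_nhds.2 hw).prodMk_nhds (tendsto_pi_nhds.2 hy')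

lemma exists_subseq_tendsto_of_asymmetry_tendsto {p : ℝ≥0∞} (hp : 1 ≤ p)
    (hθ₀ : θ₀ ∈ identifiableParams k) (hG : G ∈ zeroSymmetric) {θ : ℕ → Param k}
    (hθ : ∀ m, θ m ∈ paramSpace k)
    (h : Tendsto (fun m => asymmetry p (mixture (θ₀, G)) (θ m)) atTop (𝓝 0)) :
    ∃ φ : ℕ → ℕ, Tendsto (fun m => θ (φ m)) atTop (𝓝 θ₀) := by
  have hle : ∀ m j, (θ m).1 j ∈ Set.Icc (0 : ℝ) 1 := fun m j =>
    ⟨(hθ m).1 j, (hθ m).2.1 ▸ Finset.single_le_sum (fun i _ => (hθ m).1 i) (Finset.mem_univ j)⟩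
  obtain ⟨⟨w, y, d, s⟩, φ, hφ, hlim⟩ := CompactSpace.tendsto_subseq
    (X := (Fin k → Set.Icc (0 : ℝ) 1) × (Fin k → EReal) × (Fin k × Fin k → EReal) ×
      (Fin k × Fin k → EReal))
    (fun m => (fun j => ⟨(θ m).1 j, hle m j⟩, fun j => ((θ m).2 j : ℝ),
      fun j => ((θ m).2 j.1 - (θ m).2 j.2 : ℝ), fun j => (-(θ m).2 j.1 - (θ m).2 j.2 : ℝ)))
  rw [nhds_prod_eq, nhds_prod_eq, nhds_prod_eq, tendsto_prod_iff', tendsto_prod_iff',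
    tendsto_prod_iff'] at hlim
  obtain ⟨h1, h2, h3, h4⟩ := hlim
  rw [tendsto_pi_nhds] at h1 h2 h3 h4
  refine ⟨φ, tendsto_of_asymmetry_tendsto_of_extended_limits hp hθ₀ hG (fun m => hθ (φ m))
    (h.comp hφ.tendsto_atTop) (w := fun j => w j) (fun j => ?_) h2 h3 h4⟩
  exact (continuous_subtype_val.tendsto _).comp (h1 j)

/-- Parameters with small asymmetry are close to the true one. -/
lemma exists_forall_asymmetry_lt {p : ℝ≥0∞} (hp : 1 ≤ p)
    (hθ₀ : θ₀ ∈ identifiableParams k) (hG : G ∈ zeroSymmetric) {U : Set (Param k)}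
    (hU : U ∈ 𝓝 θ₀) :
    ∃ ε : ℝ≥0∞, 0 < ε ∧ ∀ θ ∈ paramSpace k, asymmetry p (mixture (θ₀, G)) θ < ε → θ ∈ U := by
  by_contra! hcon
  have hpos : ∀ m : ℕ, (0 : ℝ≥0∞) < (m : ℝ≥0∞)⁻¹ := fun m => by simp
  choose θ hθ hlt hnot using fun m : ℕ => hcon _ (hpos m)
  have hlim : Tendsto (fun m => asymmetry p (mixture (θ₀, G)) (θ m)) atTop (𝓝 0) :=
    tendsto_of_tendsto_of_tendsto_of_le_of_le tendsto_const_nhds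
      ENNReal.tendsto_inv_nat_nhds_zero (fun _ => zero_le) fun m => (hlt m).le
  obtain ⟨φ, hφ⟩ := exists_subseq_tendsto_of_asymmetry_tendsto hp hθ₀ hG hθ hlim
  obtain ⟨m, hm⟩ := (hφ.eventually hU).exists
  exact hnot _ hm

end Identification

/-! ### Uniform convergence of distribution functions -/

section GlivenkoCantelli

variable (F : Measure ℝ) [IsProbabilityMeasure F]

lemma exists_quantile {u : ℝ} (hu0 : 0 < u) (hu1 : u < 1) :
    ∃ q : ℝ, (∀ t, q ≤ t ↔ u ≤ cdf F t) ∧ F.real (Set.Iio q) ≤ u := by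
  set S : Set ℝ := {t | u ≤ cdf F t} with hS
  have hne : S.Nonempty := ((tendsto_cdf_atTop F).eventually (lt_mem_nhds hu1)).exists.imp
    fun t ht => le_of_lt ht
  have hbdd : BddBelow S := by
    obtain ⟨a, ha⟩ := ((tendsto_cdf_atBot F).eventually (gt_mem_nhds hu0)).exists
    refine ⟨a, fun t ht => ?_⟩
    by_contra hta
    exact absurd (ht.trans (monotone_cdf F (not_le.1 hta).le)) (not_le.2 ha)
  have hmem : u ≤ cdf F (sInf S) := by
    refine ge_of_tendsto (continuousWithinAt_cdf F (sInf S)) ?_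
    filter_upwards [self_mem_nhdsWithin] with t ht
    obtain ⟨s, hs, hst⟩ := exists_lt_of_csInf_lt hne ht
    exact le_trans hs (monotone_cdf F hst.le)
  refine ⟨sInf S, fun t => ⟨fun h => hmem.trans (monotone_cdf F h), fun h => csInf_le hbdd h⟩, ?_⟩
  rw [measureReal_def, ← measure_cdf F, StieltjesFunction.measure_Iio _ (tendsto_cdf_atBot F)]
  refine ENNReal.toReal_le_of_le_ofReal hu0.le (ENNReal.ofReal_le_ofReal ?_)
  rw [sub_zero]
  refine le_of_tendsto ((monotone_cdf F).tendsto_leftLim _) ?_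
  filter_upwards [self_mem_nhdsWithin] with t ht
  by_contra hut
  exact absurd (csInf_le hbdd (not_le.1 hut).le) (not_le.2 ht)

/-- The upper bound is strict except in the last cell, which must contain v = 1. -/
lemma exists_grid_interval {N : ℕ} (hN : 0 < N) {v : ℝ} (h0 : 0 ≤ v) (h1 : v ≤ 1) :
    ∃ i < N, (i : ℝ) / N ≤ v ∧ v ≤ (i + 1) / N ∧ (i + 1 < N → v < (i + 1) / N) := by
  have hN' : (0 : ℝ) < N := by exact_mod_cast hN
  rcases lt_or_ge ⌊v * N⌋₊ N with h | h
  · have hlt : v < (⌊v * N⌋₊ + 1) / N := by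
      rw [lt_div_iff₀ hN']
      exact Nat.lt_floor_add_one _
    refine ⟨⌊v * N⌋₊, h, ?_, hlt.le, fun _ => hlt⟩
    rw [div_le_iff₀ hN']
    exact Nat.floor_le (by positivity)
  · have hv : (N : ℝ) ≤ v * N := (Nat.le_floor_iff (by positivity)).1 h
    have hv1 : v = 1 := by
      refine le_antisymm h1 ?_
      nlinarith
    obtain ⟨M, rfl⟩ := Nat.exists_eq_succ_of_ne_zero hN.ne'
    refine ⟨M, Nat.lt_succ_self M, ?_, ?_, fun h => absurd h (by simp)⟩
    · rw [hv1, div_le_one hN']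
      simp
    · rw [hv1, one_le_div hN']
      simp

/-- Convergence on countably many half-lines implies uniform convergence of the distribution
functions. -/
lemma exists_countable_halfLines : ∃ q : ℕ × ℕ → ℝ, ∀ A : ℕ → Measure ℝ,
    (∀ᶠ n in atTop, IsProbabilityMeasure (A n)) →
    (∀ i, Tendsto (fun n => (A n).real (Set.Iic (q i))) atTop (𝓝 (F.real (Set.Iic (q i))))) →
    (∀ i, Tendsto (fun n => (A n).real (Set.Iio (q i))) atTop (𝓝 (F.real (Set.Iio (q i))))) →
    ∀ ε > 0, ∀ᶠ n in atTop, ∀ t, |cdf (A n) t - cdf F t| ≤ ε := by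
  -- The pair (N, i) indexes the i/N-quantile of F, with a dummy value 0 unless 0 < i < N.
  have hex : ∀ i : ℕ × ℕ, ∃ q : ℝ, 0 < i.2 → i.2 < i.1 →
      (∀ t, q ≤ t ↔ (i.2 : ℝ) / i.1 ≤ cdf F t) ∧ F.real (Set.Iio q) ≤ (i.2 : ℝ) / i.1 := by
    intro i
    by_cases h : 0 < i.2 ∧ i.2 < i.1
    · have h2 : (0 : ℝ) < i.2 := by exact_mod_cast h.1
      have h1 : (i.2 : ℝ) < i.1 := by exact_mod_cast h.2
      obtain ⟨q, hq⟩ := exists_quantile F (u := (i.2 : ℝ) / i.1) (div_pos h2 (h2.trans h1))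
        ((div_lt_one (h2.trans h1)).2 h1)
      exact ⟨q, fun _ _ => hq⟩
    · exact ⟨0, fun h1 h2 => absurd ⟨h1, h2⟩ h⟩
  choose q hq using hex
  refine ⟨q, fun A hA hIic hIio ε hε => ?_⟩
  -- One 1/N pays for the grid cell, the other for the deviation at its endpoints.
  obtain ⟨N, hN⟩ := exists_nat_gt (2 / ε)
  have hN' : (0 : ℝ) < N := (by positivity : (0 : ℝ) < 2 / ε).trans hN
  have hNε : 1 / (N : ℝ) + 1 / N ≤ ε := by
    rw [← add_div, div_le_iff₀ hN']
    rw [div_lt_iff₀ hε] at hN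
    linarith
  have hδ : (0 : ℝ) < 1 / N := by positivity
  have e1 : ∀ᶠ n in atTop, ∀ i ∈ Finset.range N,
      |(A n).real (Set.Iic (q (N, i))) - F.real (Set.Iic (q (N, i)))| < 1 / N := by
    rw [Filter.eventually_all_finset]
    intro i _
    exact (Metric.tendsto_nhds.1 (hIic (N, i))) _ hδ
  have e2 : ∀ᶠ n in atTop, ∀ i ∈ Finset.range N,
      |(A n).real (Set.Iio (q (N, i))) - F.real (Set.Iio (q (N, i)))| < 1 / N := by
    rw [Filter.eventually_all_finset]
    intro i _
    exact (Metric.tendsto_nhds.1 (hIio (N, i))) _ hδ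
  filter_upwards [hA, e1, e2] with n hn h1 h2 t
  obtain ⟨i, hiN, hi1, hi2, hi3⟩ := exists_grid_interval (N := N) (by exact_mod_cast hN')
    (cdf_nonneg F t) (cdf_le_one F t)
  have hstep : ((i : ℝ) + 1) / N = i / N + 1 / N := add_div _ _ _
  rw [abs_le]
  constructor
  · rcases Nat.eq_zero_or_pos i with rfl | hi
    · have := cdf_nonneg (A n) t
      simp only [CharP.cast_eq_zero, zero_add] at hi2
      linarith
    · have hqi := hq (N, i) hi hiN
      have hle : q (N, i) ≤ t := (hqi.1 t).2 hi1
      have ha := abs_lt.1 (h1 i (Finset.mem_range.2 hiN))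
      have hb := (hqi.1 _).1 le_rfl
      have hc := monotone_cdf (A n) hle
      rw [cdf_eq_real] at hb hc
      simp only at hb
      linarith
  · rcases lt_or_ge (i + 1) N with hi | hi
    · have hqi := hq (N, i + 1) (Nat.succ_pos i) hi
      have hlt : t < q (N, i + 1) := by
        refine not_le.1 fun h => ?_
        have := (hqi.1 t).1 h
        push_cast at this
        exact absurd (hi3 hi) (not_lt.2 this)
      have ha := abs_lt.1 (h2 (i + 1) (Finset.mem_range.2 hi))
      have hb := hqi.2
      have hc : (A n).real (Set.Iic t) ≤ (A n).real (Set.Iio (q (N, i + 1))) :=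
        measureReal_mono fun x hx => lt_of_le_of_lt hx hlt
      rw [← cdf_eq_real] at hc
      push_cast at hb
      linarith
    · have := cdf_le_one (A n) t
      have hi' : (N : ℝ) ≤ i + 1 := by exact_mod_cast hi
      have : 1 ≤ ((i : ℝ) + 1) / N := (one_le_div hN').2 hi'
      linarith

end GlivenkoCantelli

/-! ### From uniform convergence and first moments to L_p convergence -/

section Tails

/-- The tail of a distribution on the side of `t` away from the origin. -/
noncomputable def tail (F : Measure ℝ) (t : ℝ) : ℝ≥0∞ :=
  if t < 0 then ENNReal.ofReal (cdf F t) else ENNReal.ofReal (1 - cdf F t)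

lemma measurable_tail (F : Measure ℝ) : Measurable (tail F) :=
  Measurable.ite measurableSet_Iio (measurable_cdf F).ennreal_ofReal
    ((measurable_cdf F).const_sub 1).ennreal_ofReal

/-- Tonelli on the region between 0 and x: its section at x has length |x|, its section at t has
F-mass `tail F t`. -/
lemma lintegral_tail (F : Measure ℝ) [IsProbabilityMeasure F] :
    ∫⁻ t, tail F t = ∫⁻ x, ‖x‖ₑ ∂F := by
  set S : Set (ℝ × ℝ) := {z | (z.2 ≤ z.1 ∧ z.1 < 0) ∨ (0 ≤ z.1 ∧ z.1 < z.2)} with hS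
  have hSm : MeasurableSet S :=
    ((measurableSet_le measurable_snd measurable_fst).inter
      (measurableSet_lt measurable_fst measurable_const)).union
    ((measurableSet_le measurable_const measurable_fst).inter
      (measurableSet_lt measurable_fst measurable_snd))
  have h1 := Measure.prod_apply (μ := volume) (ν := F) hSm
  rw [Measure.prod_apply_symm hSm] at h1
  have e1 : ∀ t, tail F t = F (Prod.mk t ⁻¹' S) := by
    intro t
    unfold tail
    split_ifs with ht
    · rw [ofReal_cdf]
      congr 1
      ext x
      simp [hS, ht, not_le.2 ht]
    · rw [cdf_eq_real, ← probReal_compl_eq_one_sub measurableSet_Iic, ofReal_measureReal]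
      congr 1
      ext x
      simp [hS, ht, not_lt.1 ht]
  have e2 : ∀ x : ℝ, ‖x‖ₑ = volume ((fun t => (t, x)) ⁻¹' S) := by
    intro x
    rw [← ofReal_norm, Real.norm_eq_abs]
    rcases le_total 0 x with hx | hx
    · have : (fun t => (t, x)) ⁻¹' S = Set.Ico 0 x := by
        ext t
        simp only [hS, Set.mem_preimage, Set.mem_ofPred_eq, Set.mem_Ico]
        constructor
        · rintro (h | h)
          · linarith [h.1, h.2]
          · exact h
        · exact Or.inr
      rw [this, Real.volume_Ico, abs_of_nonneg hx, sub_zero]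
    · have : (fun t => (t, x)) ⁻¹' S = Set.Ico x 0 := by
        ext t
        simp only [hS, Set.mem_preimage, Set.mem_ofPred_eq, Set.mem_Ico]
        constructor
        · rintro (h | h)
          · exact h
          · linarith [h.1, h.2]
        · exact Or.inl
      rw [this, Real.volume_Ico, abs_of_nonpos hx, zero_sub]
  simp_rw [e1, e2]
  exact h1.symm

lemma enorm_cdf_sub_le (A B : Measure ℝ) (t : ℝ) :
    ‖cdf A t - cdf B t‖ₑ ≤ tail A t + tail B t := by
  rw [← ofReal_norm, Real.norm_eq_abs]
  have a0 := cdf_nonneg A t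
  have a1 := cdf_le_one A t
  have b0 := cdf_nonneg B t
  have b1 := cdf_le_one B t
  unfold tail
  split_ifs
  · rw [← ENNReal.ofReal_add a0 b0]
    refine ENNReal.ofReal_le_ofReal (abs_le.2 ⟨?_, ?_⟩) <;> linarith
  · rw [← ENNReal.ofReal_add (by linarith) (by linarith)]
    refine ENNReal.ofReal_le_ofReal (abs_le.2 ⟨?_, ?_⟩) <;> linarith

/-- Dominated convergence to zero with a convergent sequence of dominating functions. -/
lemma tendsto_lintegral_zero_of_le {α : Type*} [MeasurableSpace α] {μ : Measure α}
    {f g : ℕ → α → ℝ≥0∞} {g' : α → ℝ≥0∞} (hf : ∀ n, Measurable (f n)) (hg : ∀ n, Measurable (g n))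
    (hg' : Measurable g') (hfg : ∀ n x, f n x ≤ g n x)
    (hf0 : ∀ x, Tendsto (fun n => f n x) atTop (𝓝 0))
    (hgg : ∀ x, Tendsto (fun n => g n x) atTop (𝓝 (g' x)))
    (hint : Tendsto (fun n => ∫⁻ x, g n x ∂μ) atTop (𝓝 (∫⁻ x, g' x ∂μ)))
    (hfin : ∫⁻ x, g' x ∂μ ≠ ∞) :
    Tendsto (fun n => ∫⁻ x, f n x ∂μ) atTop (𝓝 0) := by
  have h1 : Tendsto (fun n => ∫⁻ x, min (f n x) (g' x) ∂μ) atTop (𝓝 (∫⁻ _, 0 ∂μ)) := by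
    refine tendsto_lintegral_of_dominated_convergence g' (fun n => (hf n).min hg')
      (fun n => ae_of_all _ fun x => min_le_right _ _) hfin (ae_of_all _ fun x => ?_)
    simpa using (hf0 x).min (tendsto_const_nhds (x := g' x))
  have h2 : Tendsto (fun n => ∫⁻ x, min (g n x) (g' x) ∂μ) atTop (𝓝 (∫⁻ x, g' x ∂μ)) := by
    refine tendsto_lintegral_of_dominated_convergence g' (fun n => (hg n).min hg')
      (fun n => ae_of_all _ fun x => min_le_right _ _) hfin (ae_of_all _ fun x => ?_)
    simpa using (hgg x).min (tendsto_const_nhds (x := g' x))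
  have h3 : Tendsto (fun n => ∫⁻ x, g n x - min (g n x) (g' x) ∂μ) atTop (𝓝 0) := by
    have := ENNReal.Tendsto.sub hint h2 (Or.inl hfin)
    rw [tsub_self] at this
    refine this.congr fun n => ?_
    rw [lintegral_sub ((hg n).min hg')]
    · exact ne_top_of_le_ne_top hfin (lintegral_mono fun x => min_le_right _ _)
    · exact ae_of_all _ fun x => min_le_left _ _
  have h4 := h1.add h3
  rw [lintegral_zero, add_zero] at h4
  -- The bound is f ≤ min(f, g') + (g - min(g, g')).
  refine tendsto_of_tendsto_of_tendsto_of_le_of_le tendsto_const_nhds h4 (fun _ => zero_le)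
    fun n => ?_
  rw [← lintegral_add_left ((hf n).min hg')]
  refine lintegral_mono fun x => ?_
  have hx := hfg n x
  rcases le_total (f n x) (g' x) with h | h
  · simp [h]
  · rw [min_eq_right h, min_eq_right (h.trans hx), add_tsub_cancel_of_le (h.trans hx)]
    exact hx

/-- For finite p, the p-th power of a difference bounded by 1 is at most the difference, hence at
most the sum of the tails, whose integrals converge with the first moments. -/
lemma tendsto_lpDist {p : ℝ≥0∞} (hp : 1 ≤ p) {A : ℕ → Measure ℝ} {F : Measure ℝ}
    [IsProbabilityMeasure F] (hA : ∀ n, IsProbabilityMeasure (A n))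
    (hunif : ∀ ε > 0, ∀ᶠ n in atTop, ∀ t, |cdf (A n) t - cdf F t| ≤ ε)
    (hfin : p ≠ ∞ → ∫⁻ x, ‖x‖ₑ ∂F ≠ ∞)
    (hmom : p ≠ ∞ → Tendsto (fun n => ∫⁻ x, ‖x‖ₑ ∂(A n)) atTop (𝓝 (∫⁻ x, ‖x‖ₑ ∂F))) :
    Tendsto (fun n => lpDist p (A n) F) atTop (𝓝 0) := by
  by_cases hpt : p = ∞
  · rw [ENNReal.tendsto_nhds_zero]
    intro ε hε
    by_cases hεt : ε = ∞
    · simp [hεt]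
    · filter_upwards [hunif ε.toReal (ENNReal.toReal_pos hε.ne' hεt)] with n hn
      rw [lpDist, if_pos hpt]
      refine iSup_le fun t => ?_
      rw [← ofReal_norm, ← ENNReal.ofReal_toReal hεt]
      exact ENNReal.ofReal_le_ofReal (hn t)
  · have hp1 : 1 ≤ p.toReal := by
      rw [← ENNReal.toReal_one]
      exact ENNReal.toReal_mono hpt hp
    have hcdf : ∀ t, Tendsto (fun n => cdf (A n) t) atTop (𝓝 (cdf F t)) := fun t => by
      rw [Metric.tendsto_nhds]
      intro ε hε
      filter_upwards [hunif (ε / 2) (by positivity)] with n hn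
      rw [Real.dist_eq]
      linarith [hn t]
    simp only [lpDist, if_neg hpt]
    have key : Tendsto (fun n => ∫⁻ t : ℝ, ‖cdf (A n) t - cdf F t‖ₑ ^ p.toReal) atTop (𝓝 0) := by
      refine tendsto_lintegral_zero_of_le (g := fun n t => tail (A n) t + tail F t)
        (g' := fun t => tail F t + tail F t) (fun n => ?_)
        (fun n => (measurable_tail _).add (measurable_tail _))
        ((measurable_tail _).add (measurable_tail _)) (fun n t => ?_) (fun t => ?_) (fun t => ?_)
        ?_ ?_
      · exact (((measurable_cdf _).sub (measurable_cdf _)).enorm).pow_const _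
      · refine le_trans ?_ (enorm_cdf_sub_le (A n) F t)
        have hle : ‖cdf (A n) t - cdf F t‖ₑ ≤ 1 := by
          rw [← ofReal_norm, ← ENNReal.ofReal_one, Real.norm_eq_abs]
          refine ENNReal.ofReal_le_ofReal (abs_le.2 ⟨?_, ?_⟩) <;>
            linarith [cdf_nonneg (A n) t, cdf_le_one (A n) t, cdf_nonneg F t, cdf_le_one F t]
        simpa using ENNReal.rpow_le_rpow_of_exponent_ge hle hp1
      · have h0 : Tendsto (fun n => ‖cdf (A n) t - cdf F t‖ₑ) atTop (𝓝 0) := by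
          simpa using ((hcdf t).sub_const (cdf F t)).enorm
        have := (ENNReal.continuous_rpow_const (y := p.toReal)).continuousAt.tendsto.comp h0
        simpa [Function.comp_def, ENNReal.zero_rpow_of_pos (zero_lt_one.trans_le hp1)] using this
      · refine Tendsto.add_const _ ?_
        unfold tail
        split_ifs
        · exact (ENNReal.continuous_ofReal.tendsto _).comp (hcdf t)
        · exact (ENNReal.continuous_ofReal.tendsto _).comp ((hcdf t).const_sub 1)
      · simp_rw [lintegral_add_left (measurable_tail _), lintegral_tail]
        exact (hmom hpt).add_const _
      · rw [lintegral_add_left (measurable_tail _), lintegral_tail]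
        exact ENNReal.add_ne_top.2 ⟨hfin hpt, hfin hpt⟩
    have h1p : 0 < 1 / p.toReal := by positivity
    have := (ENNReal.continuous_rpow_const (y := 1 / p.toReal)).continuousAt.tendsto.comp key
    simpa only [Function.comp_def, ENNReal.zero_rpow_of_pos h1p] using this

end Tails

/-! ### Strong law for empirical distributions -/

section Empirical

lemma isProbabilityMeasure_empirical {n : ℕ} (hn : n ≠ 0) (x : ℕ → ℝ) :
    IsProbabilityMeasure (empirical n x) := by
  refine ⟨?_⟩
  simp only [empirical, Measure.smul_apply, Measure.coe_finsetSum, Finset.sum_apply, measure_univ,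
    Finset.sum_const, Finset.card_range, nsmul_eq_mul, mul_one, smul_eq_mul]
  exact ENNReal.inv_mul_cancel (by exact_mod_cast hn) (ENNReal.natCast_ne_top n)

lemma empirical_real (n : ℕ) (x : ℕ → ℝ) {s : Set ℝ} (hs : MeasurableSet s) :
    (empirical n x).real s = (∑ i ∈ Finset.range n, s.indicator (fun _ => (1 : ℝ)) (x i)) / n := by
  simp only [empirical, measureReal_def, Measure.smul_apply, Measure.coe_finsetSum,
    Finset.sum_apply, smul_eq_mul, ENNReal.toReal_mul, ENNReal.toReal_inv, ENNReal.toReal_natCast]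
  rw [ENNReal.toReal_sum (fun i _ => measure_ne_top _ _), div_eq_inv_mul]
  congr 1
  refine Finset.sum_congr rfl fun i _ => ?_
  rw [Measure.dirac_apply' _ hs]
  by_cases h : x i ∈ s <;> simp [h]

lemma lintegral_enorm_empirical {n : ℕ} (hn : n ≠ 0) (x : ℕ → ℝ) :
    ∫⁻ y, ‖y‖ₑ ∂(empirical n x) = ENNReal.ofReal ((∑ i ∈ Finset.range n, ‖x i‖) / n) := by
  have hn' : (0 : ℝ) < n := by exact_mod_cast Nat.pos_of_ne_zero hn
  rw [empirical, lintegral_smul_measure, lintegral_finsetSum_measure, div_eq_inv_mul,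
    ENNReal.ofReal_mul (by positivity), ENNReal.ofReal_inv_of_pos hn', ENNReal.ofReal_natCast,
    ENNReal.ofReal_sum_of_nonneg (fun i _ => norm_nonneg _)]
  simp only [lintegral_dirac, ofReal_norm, smul_eq_mul]

variable {Ω : Type*} [MeasurableSpace Ω] {P : Measure Ω}
  {X : ℕ → Ω → ℝ} {F : Measure ℝ}

lemma ae_tendsto_average (hXmeas : ∀ i, Measurable (X i)) (hXindep : iIndepFun X P)
    (hXlaw : ∀ i, P.map (X i) = F) {f : ℝ → ℝ} (hf : Measurable f) (hint : Integrable f F) :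
    ∀ᵐ ω ∂P, Tendsto (fun n : ℕ => (∑ i ∈ Finset.range n, f (X i ω)) / n) atTop
      (𝓝 (∫ x, f x ∂F)) := by
  have h := strong_law_ae_real (μ := P) (fun i ω => f (X i ω)) ?_ ?_ ?_
  · rw [← hXlaw 0, integral_map (hXmeas 0).aemeasurable hf.aestronglyMeasurable]
    exact h
  · rw [← hXlaw 0] at hint
    exact hint.comp_measurable (hXmeas 0)
  · intro i j hij
    exact (hXindep.indepFun hij).comp hf hf
  · intro i
    have : IdentDistrib (X i) (X 0) P P :=
      ⟨(hXmeas i).aemeasurable, (hXmeas 0).aemeasurable, by rw [hXlaw, hXlaw]⟩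
    exact this.comp hf

lemma ae_tendsto_empirical_real [IsProbabilityMeasure F] (hXmeas : ∀ i, Measurable (X i))
    (hXindep : iIndepFun X P) (hXlaw : ∀ i, P.map (X i) = F) {s : Set ℝ} (hs : MeasurableSet s) :
    ∀ᵐ ω ∂P, Tendsto (fun n : ℕ => (empirical n fun i => X i ω).real s) atTop (𝓝 (F.real s)) := by
  have h := ae_tendsto_average hXmeas hXindep hXlaw (f := s.indicator fun _ => (1 : ℝ))
    (measurable_const.indicator hs) ((integrable_const _).indicator hs)
  filter_upwards [h] with ω hω
  simp_rw [empirical_real _ _ hs]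
  simpa [integral_indicator hs] using hω

lemma ae_tendsto_lpDist_empirical {p : ℝ≥0∞} (hp : 1 ≤ p) [IsProbabilityMeasure F]
    (hXmeas : ∀ i, Measurable (X i)) (hXindep : iIndepFun X P) (hXlaw : ∀ i, P.map (X i) = F)
    (hmoment : p ≠ ∞ → Integrable (fun x : ℝ => x) F) :
    ∀ᵐ ω ∂P, Tendsto (fun n => lpDist p (empirical n fun i => X i ω) F) atTop (𝓝 0) := by
  obtain ⟨q, hq⟩ := exists_countable_halfLines F
  have h1 := ae_all_iff.2 fun i => ae_tendsto_empirical_real hXmeas hXindep hXlaw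
    (measurableSet_Iic (a := q i))
  have h2 := ae_all_iff.2 fun i => ae_tendsto_empirical_real hXmeas hXindep hXlaw
    (measurableSet_Iio (a := q i))
  have h3 : p ≠ ∞ → ∀ᵐ ω ∂P, Tendsto (fun n : ℕ => (∑ i ∈ Finset.range n, ‖X i ω‖) / n) atTop
      (𝓝 (∫ x, ‖x‖ ∂F)) := fun hpt =>
    ae_tendsto_average hXmeas hXindep hXlaw measurable_norm (hmoment hpt).norm
  rw [← ae_all_iff] at h3
  filter_upwards [h1, h2, h3] with ω hω1 hω2 hω3
  -- The index is shifted because the empirical distribution of zero observations is the zero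
  -- measure.
  have hprob : ∀ n, IsProbabilityMeasure (empirical (n + 1) fun i => X i ω) := fun n =>
    isProbabilityMeasure_empirical n.succ_ne_zero _
  rw [← tendsto_add_atTop_iff_nat 1]
  refine tendsto_lpDist hp hprob ?_ (fun hpt => ?_) (fun hpt => ?_)
  · exact hq _ (Eventually.of_forall hprob) (fun i => (tendsto_add_atTop_iff_nat 1).2 (hω1 i))
      (fun i => (tendsto_add_atTop_iff_nat 1).2 (hω2 i))
  · exact (hmoment hpt).2.ne
  · simp_rw [lintegral_enorm_empirical (Nat.succ_ne_zero _)]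
    rw [← ofReal_integral_norm_eq_lintegral_enorm (hmoment hpt)]
    exact (ENNReal.continuous_ofReal.tendsto _).comp
      ((tendsto_add_atTop_iff_nat 1).2 (hω3 hpt))

end Empirical

/-! ### Existence and convergence of minimizers -/

section Consistency

variable {k : ℕ} {p : ℝ≥0∞} {θ₀ : Param k} {G : Measure ℝ}

lemma isProbabilityMeasure_mixture (hθ₀ : θ₀ ∈ paramSpace k) (hG : G ∈ zeroSymmetric) :
    IsProbabilityMeasure (mixture (θ₀, G)) := by
  have := isProbabilityMeasure_pointMix hθ₀.1 hθ₀.2.1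
  have := hG.1
  unfold mixture
  infer_instance

lemma integrable_mixture (hG : G ∈ zeroSymmetric) (h : Integrable (fun x : ℝ => x) G) :
    Integrable (fun x : ℝ => x) (mixture (θ₀, G)) := by
  have := hG.1
  refine ⟨measurable_id.aestronglyMeasurable, ?_⟩
  rw [HasFiniteIntegral, mixture, Measure.conv_comm, Measure.lintegral_conv measurable_enorm]
  simp only [pointMix]
  rw [lintegral_finsetSum_measure, ENNReal.sum_lt_top]
  intro j _
  rw [lintegral_smul_measure, lintegral_dirac, smul_eq_mul]
  refine ENNReal.mul_lt_top ENNReal.ofReal_lt_top ?_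
  exact ((integrable_const (θ₀.2 j)).add h).2

lemma asymmetry_mixture_self (hp : 1 ≤ p) (hθ₀ : θ₀ ∈ paramSpace k) (hG : G ∈ zeroSymmetric) :
    asymmetry p (mixture (θ₀, G)) θ₀ = 0 := by
  have := isProbabilityMeasure_pointMix hθ₀.1 hθ₀.2.1
  have := isProbabilityMeasure_mixture hθ₀ hG
  have hs : (G ∗ (pointMix θ₀ ∗ reflect (pointMix θ₀))) ∈ zeroSymmetric :=
    conv_mem_zeroSymmetric hG
  have := hG.1
  unfold asymmetry
  rw [reflect_conv_pointMix]
  unfold mixture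
  simp only [Measure.conv_assoc]
  rw [hs.2]
  exact lpDist_self hp _

lemma asymmetry_le_liminf (hp : 1 ≤ p) (F : Measure ℝ) [IsProbabilityMeasure F]
    {θ : ℕ → Param k} {θ' : Param k} (hθ : ∀ m, θ m ∈ paramSpace k) (hθ' : θ' ∈ paramSpace k)
    (h : Tendsto θ atTop (𝓝 θ')) :
    asymmetry p F θ' ≤ liminf (fun m => asymmetry p F (θ m)) atTop := by
  have hw := tendsto_pi_nhds.1 ((continuous_fst.tendsto _).comp h)
  have hy := tendsto_pi_nhds.1 ((continuous_snd.tendsto _).comp h)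
  have := eLpNorm_extCdf_le_liminf (p := p) F (reflect F) (w := fun m => (θ m).1) (w' := θ'.1) hw
    (u := fun m => (θ m).2) (v := fun m j => -(θ m).2 j)
    (y := fun j => (θ'.2 j : EReal)) (z := fun j => ((-θ'.2 j : ℝ) : EReal))
    (fun j => EReal.tendsto_coe.2 (hy j)) (fun j => EReal.tendsto_coe.2 (hy j).neg)
  simp_rw [extCdf_add_coe] at this
  rw [asymmetry_eq_eLpNorm hp F hθ'.1 hθ'.2.1]
  simp_rw [fun m => asymmetry_eq_eLpNorm hp F (hθ m).1 (hθ m).2.1]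
  exact this

/-- An empirical distribution close to the truth admits a minimizer. -/
lemma exists_isMinOn_asymmetry (hp : 1 ≤ p) (F : Measure ℝ) [IsProbabilityMeasure F]
    {K : Set (Param k)} (hK : IsCompact K) (hKmono : ∀ θ ∈ K, StrictMono θ.2)
    {ε : ℝ≥0∞} (hθ₀ : θ₀ ∈ paramSpace k) (hlt : asymmetry p F θ₀ < ε)
    (hsub : ∀ θ ∈ paramSpace k, asymmetry p F θ < ε → θ ∈ K) :
    ∃ θ ∈ paramSpace k, IsMinOn (asymmetry p F) (paramSpace k) θ := by
  have hne : (asymmetry p F '' paramSpace k).Nonempty := ⟨_, θ₀, hθ₀, rfl⟩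
  obtain ⟨a, -, ha, hmem⟩ := exists_seq_tendsto_sInf hne (OrderBot.bddBelow _)
  choose θ hθ hθa using hmem
  have hinf : sInf (asymmetry p F '' paramSpace k) < ε :=
    (sInf_le (Set.mem_image_of_mem _ hθ₀)).trans_lt hlt
  obtain ⟨M, hM⟩ := eventually_atTop.1 (ha.eventually (gt_mem_nhds hinf))
  obtain ⟨θ', hθ'K, φ, hφ, hlim⟩ := hK.tendsto_subseq (x := fun m => θ (m + M))
    fun m => hsub _ (hθ _) (by rw [hθa]; exact hM _ (Nat.le_add_left _ _))
  have hw : ∀ j, Tendsto (fun m => (θ (φ m + M)).1 j) atTop (𝓝 (θ'.1 j)) :=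
    tendsto_pi_nhds.1 ((continuous_fst.tendsto _).comp hlim)
  -- The parameter space is not closed; strict monotonicity of the limit comes from membership in K.
  have hθ' : θ' ∈ paramSpace k := by
    refine ⟨fun j => ge_of_tendsto' (hw j) fun m => (hθ _).1 j, ?_, hKmono _ hθ'K⟩
    refine tendsto_nhds_unique (tendsto_finsetSum _ fun j _ => hw j) ?_
    simp [(hθ _).2.1]
  refine ⟨θ', hθ', fun η hη => ?_⟩
  have hle := asymmetry_le_liminf hp F (θ := fun m => θ (φ m + M)) (fun m => hθ _) hθ' hlim
  simp_rw [hθa] at hle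
  have ht : Tendsto (fun m => a (φ m + M)) atTop
      (𝓝 (sInf (asymmetry p F '' paramSpace k))) :=
    ha.comp ((tendsto_add_atTop_nat M).comp hφ.tendsto_atTop)
  rw [ht.liminf_eq] at hle
  exact hle.trans (sInf_le ⟨η, hη, rfl⟩)

variable {x : ℕ → ℝ}

lemma eventually_nonempty_minimizers (hp : 1 ≤ p) (hθ₀ : θ₀ ∈ identifiableParams k)
    (hG : G ∈ zeroSymmetric)
    (hx : Tendsto (fun n => lpDist p (empirical n x) (mixture (θ₀, G))) atTop (𝓝 0)) :
    ∀ᶠ n in atTop, (minimizers k p n x).Nonempty := by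
  have hF := isProbabilityMeasure_mixture hθ₀.1 hG
  have hnhds : {θ : Param k | StrictMono θ.2} ∈ 𝓝 θ₀ :=
    (isOpen_strictMono.preimage continuous_snd).mem_nhds hθ₀.1.2.2
  obtain ⟨K, hK, hKs, hKc⟩ := local_compact_nhds hnhds
  obtain ⟨ε, hε, hεK⟩ := exists_forall_asymmetry_lt hp hθ₀ hG hK
  have hδ : Tendsto (fun n => 2 * lpDist p (empirical n x) (mixture (θ₀, G))) atTop (𝓝 0) := by
    simpa using ENNReal.Tendsto.const_mul hx (Or.inr (by simp : (2 : ℝ≥0∞) ≠ ∞))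
  -- Half of ε bounds the empirical asymmetry, the other half the cost of passing back to the true
  -- mixture.
  have hε2 : 0 < ε / 2 := ENNReal.half_pos hε.ne'
  filter_upwards [hδ.eventually (gt_mem_nhds hε2), eventually_ne_atTop 0] with n hn hn0
  have := isProbabilityMeasure_empirical hn0 x
  refine exists_isMinOn_asymmetry hp (empirical n x) hKc hKs (ε := ε / 2) hθ₀.1 ?_ ?_
  · refine lt_of_le_of_lt (asymmetry_le_add hp _ (mixture (θ₀, G)) hθ₀.1.1 hθ₀.1.2.1) ?_
    rwa [asymmetry_mixture_self hp hθ₀.1 hG, zero_add]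
  · intro θ hθ hlt
    refine hεK θ hθ (lt_of_le_of_lt
      (asymmetry_le_add hp (mixture (θ₀, G)) (empirical n x) hθ.1 hθ.2.1) ?_)
    rw [lpDist_comm hp]
    exact (ENNReal.add_lt_add hlt hn).trans_eq (ENNReal.add_halves ε)

lemma tendsto_of_mem_minimizers (hp : 1 ≤ p) (hθ₀ : θ₀ ∈ identifiableParams k)
    (hG : G ∈ zeroSymmetric)
    (hx : Tendsto (fun n => lpDist p (empirical n x) (mixture (θ₀, G))) atTop (𝓝 0))
    {θ : ℕ → Param k} (hθ : ∀ᶠ n in atTop, θ n ∈ minimizers k p n x) :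
    Tendsto θ atTop (𝓝 θ₀) := by
  have hF := isProbabilityMeasure_mixture hθ₀.1 hG
  -- Twice the distance is paid at the minimizer and twice more at θ₀.
  have hδ : Tendsto (fun n => 4 * lpDist p (empirical n x) (mixture (θ₀, G))) atTop (𝓝 0) := by
    simpa using ENNReal.Tendsto.const_mul hx (Or.inr (by simp : (4 : ℝ≥0∞) ≠ ∞))
  intro U hU
  obtain ⟨ε, hε, hεU⟩ := exists_forall_asymmetry_lt hp hθ₀ hG hU
  change ∀ᶠ n in atTop, θ n ∈ U
  filter_upwards [hδ.eventually (gt_mem_nhds hε), eventually_ne_atTop 0, hθ] with n hn hn0 hmin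
  have := isProbabilityMeasure_empirical hn0 x
  refine hεU _ hmin.1 (lt_of_le_of_lt ?_ hn)
  calc asymmetry p (mixture (θ₀, G)) (θ n)
      ≤ asymmetry p (empirical n x) (θ n) + 2 * lpDist p (empirical n x) (mixture (θ₀, G)) := by
        rw [lpDist_comm hp]
        exact asymmetry_le_add hp _ _ hmin.1.1 hmin.1.2.1
    _ ≤ asymmetry p (empirical n x) θ₀ + 2 * lpDist p (empirical n x) (mixture (θ₀, G)) := by
        gcongr
        exact hmin.2 hθ₀.1
    _ ≤ (asymmetry p (mixture (θ₀, G)) θ₀ + 2 * lpDist p (empirical n x) (mixture (θ₀, G))) +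
        2 * lpDist p (empirical n x) (mixture (θ₀, G)) := by
        gcongr
        exact asymmetry_le_add hp _ _ hθ₀.1.1 hθ₀.1.2.1
    _ = 4 * lpDist p (empirical n x) (mixture (θ₀, G)) := by
        rw [asymmetry_mixture_self hp hθ₀.1 hG]
        ring

end Consistency

end SymMix

theorem theorem3 {Ω : Type*} [MeasurableSpace Ω] (P : Measure Ω) [IsProbabilityMeasure P]
    (k : ℕ) (p : ℝ≥0∞) (hp : 1 ≤ p)
    (G₀ : Measure ℝ) (hG₀ : G₀ ∈ SymMix.zeroSymmetric)
    (hmoment : p ≠ ∞ → Integrable (fun x : ℝ => x) G₀)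
    (θ₀ : SymMix.Param k) (hθ₀ : θ₀ ∈ SymMix.identifiableParams k)
    (X : ℕ → Ω → ℝ) (hXmeas : ∀ i, Measurable (X i)) (hXindep : iIndepFun X P)
    (hXlaw : ∀ i, P.map (X i) = SymMix.mixture (θ₀, G₀)) :
    (∀ᵐ ω ∂P, ∀ᶠ n in atTop, (SymMix.minimizers k p n (fun i => X i ω)).Nonempty) ∧
    ∀ θhat : ℕ → Ω → SymMix.Param k,
      (∀ᵐ ω ∂P, ∀ᶠ n in atTop, θhat n ω ∈ SymMix.minimizers k p n (fun i => X i ω)) →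
      ∀ᵐ ω ∂P, Tendsto (fun n => θhat n ω) atTop (𝓝 θ₀) := by
  have := SymMix.isProbabilityMeasure_mixture hθ₀.1 hG₀
  have hconv := SymMix.ae_tendsto_lpDist_empirical hp hXmeas hXindep hXlaw
    fun hpt => SymMix.integrable_mixture hG₀ (hmoment hpt)
  constructor
  · filter_upwards [hconv] with ω hω
    exact SymMix.eventually_nonempty_minimizers hp hθ₀ hG₀ hω
  · intro θhat hθhat
    filter_upwards [hconv, hθhat] with ω hω hmin
    exact SymMix.tendsto_of_mem_minimizers hp hθ₀ hG₀ hω hmin
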